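/- Let $\gamma\in\mathbb{R}$ and let $V:(0,\infty)\to\mathbb{R}$ satisfy $\int_0^\infty |V(x)|\,dx<\infty$. Let $H=-\frac{d^2}{dx^2}+V$ be the self-adjoint operator in $L_2(\mathbb{R}_+)$ with boundary condition $u'(0)=\gamma u(0)$, defined through the quadratic form $$\int_0^\infty\left(|u'(x)|^2+V(x)|u(x)|^2\right)dx+\gamma|u(0)|^2$$ with form domain $H^1(\mathbb{R}_+)$. For $\zeta\in\mathbb{C}$ with $\operatorname{Im}\zeta\ge 0$, $\zeta\neq 0$, consider the equation $-u''+Vu=\zeta^2u$ on $(0,\infty)$ for functions $u\in C^1([0,\infty))$ with $u'$ locally absolutely continuous. Let $\varphi(\cdot,\zeta)$ be its solution with $\varphi(0,\zeta)=1$, $\varphi'(0,\zeta)=\gamma$ (the regular solution), let $\theta(\cdot,\zeta)$ be its solution with $\theta(x,\zeta)=e^{i\zeta x}(1+o(1))$ and $\theta'(x,\zeta)=i\zeta e^{i\zeta x}(1+o(1))$ as $x\to\infty$ (the Jost solution), and let $$w(\zeta)=\varphi'(x,\zeta)\theta(x,\zeta)-\theta'(x,\zeta)\varphi(x,\zeta)$$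 be their Wronskian, which does not depend on $x$ (the Jost function). Then: (i) every zero $\zeta$ of $w$ in the open upper half-plane $\operatorname{Im}\zeta>0$ lies on the imaginary axis and is simple ($w$ is analytic at $\zeta$ and vanishes there to order exactly one); (ii) for every $\zeta\neq 0$ with $\operatorname{Im}\zeta\ge 0$, $w(\zeta)=0$ if and only if $\zeta^2$ is a negative eigenvalue of $H$. -/

import Mathlib

namespace RobinHalfLine

open MeasureTheory Set Filter Topology

noncomputable section

/-! ### The differential equation, its regular solution and its Jost solution -/

/-- The derivative on the closed half-line `[0, ∞)` (one-sided at `0`). -/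
def hderiv (u : ℝ → ℂ) : ℝ → ℂ := derivWithin u (Ici 0)

/-- `u` solves `-u'' + V u = z u` on the half-line: `u` is `C¹` on `[0, ∞)`, `u'` is locally
absolutely continuous on `[0, ∞)`, and `u'' = (V - z) u` almost everywhere. -/
structure IsSolution (V : ℝ → ℝ) (z : ℂ) (u : ℝ → ℂ) : Prop where
  contDiffOn : ContDiffOn ℝ 1 u (Ici 0)
  absCont : ∀ b : ℝ, 0 ≤ b → AbsolutelyContinuousOnInterval (hderiv u) 0 b
  equation : ∀ᵐ x ∂(volume.restrict (Ioi (0 : ℝ))),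
    HasDerivAt (hderiv u) (((V x : ℂ) - z) * u x) x

/-- The regular solution: `φ(0) = 1`, `φ'(0) = γ`, at the spectral parameter `z = ζ²`. -/
structure IsRegularSolution (V : ℝ → ℝ) (γ : ℝ) (ζ : ℂ) (φ : ℝ → ℂ) : Prop where
  solution : IsSolution V (ζ ^ 2) φ
  value : φ 0 = 1
  slope : hderiv φ 0 = (γ : ℂ)

/-- The Jost solution: `θ(x) = e^{iζx}(1 + o(1))` and `θ'(x) = iζ e^{iζx}(1 + o(1))` as `x → ∞`,
at the spectral parameter `z = ζ²`. -/
structure IsJostSolution (V : ℝ → ℝ) (ζ : ℂ) (θ : ℝ → ℂ) : Prop where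
  solution : IsSolution V (ζ ^ 2) θ
  asymptotics : Tendsto (fun x : ℝ => θ x / Complex.exp (Complex.I * ζ * x)) atTop (𝓝 1)
  asymptotics_deriv : Tendsto
    (fun x : ℝ => hderiv θ x / (Complex.I * ζ * Complex.exp (Complex.I * ζ * x))) atTop (𝓝 1)

open Classical in
/-- The regular solution `φ(·, ζ)` (unique on `[0, ∞)`). -/
def regularSolution (V : ℝ → ℝ) (γ : ℝ) (ζ : ℂ) : ℝ → ℂ :=
  if h : ∃ φ, IsRegularSolution V γ ζ φ then h.choose else 0

open Classical in
/-- The Jost solution `θ(·, ζ)` (for integrable `V`, `Im ζ ≥ 0`, `ζ ≠ 0` it exists and is unique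
on `[0, ∞)`). -/
def jostSolution (V : ℝ → ℝ) (ζ : ℂ) : ℝ → ℂ :=
  if h : ∃ θ, IsJostSolution V ζ θ then h.choose else 0

/-- The Wronskian `u' v - v' u` at the point `x`. -/
def wronskian (u v : ℝ → ℂ) (x : ℝ) : ℂ := hderiv u x * v x - hderiv v x * u x

/-- The Jost function `w(ζ)`: the Wronskian of the regular solution and the Jost solution. It does
not depend on the point of `[0, ∞)`; it is evaluated at `0`. -/
def jostFunction (V : ℝ → ℝ) (γ : ℝ) (ζ : ℂ) : ℂ :=
  wronskian (regularSolution V γ ζ) (jostSolution V ζ) 0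

/-! ### The Sobolev space on the half-line and the quadratic form -/

/-- Lebesgue measure on `(0, ∞)`. -/
abbrev halfLine : Measure ℝ := volume.restrict (Ioi (0 : ℝ))

/-- The Hilbert space `L₂(ℝ₊)`. -/
abbrev L2 : Type := Lp ℂ 2 halfLine

/-- `u` is the continuous representative on `[0, ∞)` of an element of `H¹(ℝ₊)`: it is locally
absolutely continuous on `[0, ∞)`, and `u` and `u'` are square integrable on `(0, ∞)`. -/
structure MemH1 (u : ℝ → ℂ) : Prop where
  absCont : ∀ b : ℝ, 0 ≤ b → AbsolutelyContinuousOnInterval u 0 b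
  memLp : MemLp u 2 halfLine
  memLp_deriv : MemLp (deriv u) 2 halfLine

/-- The sesquilinear form (linear in `u`, antilinear in `v`) of the quadratic form
`∫₀^∞ (|u'|² + V |u|²) dx + γ |u(0)|²`. -/
def form (V : ℝ → ℝ) (γ : ℝ) (u v : ℝ → ℂ) : ℂ :=
  (∫ x in Ioi (0 : ℝ), (deriv u x * starRingEnd ℂ (deriv v x)
    + (V x : ℂ) * u x * starRingEnd ℂ (v x)))
  + (γ : ℂ) * u 0 * starRingEnd ℂ (v 0)

/-! ### Facts that make the operator of the form well defined -/

theorem ae_differentiableAt_of_absCont {u : ℝ → ℂ}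
    (hu : ∀ b : ℝ, 0 ≤ b → AbsolutelyContinuousOnInterval u 0 b) :
    ∀ᵐ x ∂halfLine, DifferentiableAt ℝ u x := by
  rw [ae_restrict_iff' measurableSet_Ioi]
  have h : ∀ n : ℕ, ∀ᵐ x : ℝ, x ∈ uIcc (0 : ℝ) n → DifferentiableAt ℝ u x := fun n =>
    (hu n (Nat.cast_nonneg n)).boundedVariationOn.ae_differentiableAt_of_mem_uIcc
  filter_upwards [ae_all_iff.2 h] with x hx hx0
  obtain ⟨n, hn⟩ := exists_nat_ge x
  exact hx n (by rw [uIcc_of_le (Nat.cast_nonneg n)]; exact ⟨le_of_lt hx0, hn⟩)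

theorem MemH1.deriv_add {u v : ℝ → ℂ} (hu : MemH1 u) (hv : MemH1 v) :
    deriv (u + v) =ᵐ[halfLine] deriv u + deriv v := by
  filter_upwards [ae_differentiableAt_of_absCont hu.absCont,
    ae_differentiableAt_of_absCont hv.absCont] with x h1 h2
  exact _root_.deriv_add h1 h2

theorem deriv_smul_fun (c : ℂ) (u : ℝ → ℂ) : deriv (c • u) = c • deriv u := by
  funext x
  simpa using deriv_const_smul_field (x := x) c u

theorem MemH1.add {u v : ℝ → ℂ} (hu : MemH1 u) (hv : MemH1 v) : MemH1 (u + v) where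
  absCont b hb := (hu.absCont b hb).add (hv.absCont b hb)
  memLp := hu.memLp.add hv.memLp
  memLp_deriv := (memLp_congr_ae (hu.deriv_add hv)).2 (hu.memLp_deriv.add hv.memLp_deriv)

theorem MemH1.smul {u : ℝ → ℂ} (c : ℂ) (hu : MemH1 u) : MemH1 (c • u) where
  absCont b hb := (hu.absCont b hb).const_smul c
  memLp := hu.memLp.const_smul c
  memLp_deriv := by rw [deriv_smul_fun]; exact hu.memLp_deriv.const_smul c

theorem memH1_zero : MemH1 (0 : ℝ → ℂ) where
  absCont b _ :=
    (LipschitzWith.const (0 : ℂ)).lipschitzOnWith.absolutelyContinuousOnInterval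
  memLp := MemLp.zero
  memLp_deriv := by
    have : deriv (0 : ℝ → ℂ) = 0 := by funext x; simp [Pi.zero_def]
    rw [this]; exact MemLp.zero

theorem absCont_clm {u : ℝ → ℂ} {b : ℝ} (L : ℂ →L[ℝ] ℝ) (hL : ∀ z, ‖L z‖ ≤ ‖z‖)
    (hu : AbsolutelyContinuousOnInterval u 0 b) :
    AbsolutelyContinuousOnInterval (fun x => L (u x)) 0 b := by
  unfold AbsolutelyContinuousOnInterval at hu ⊢
  refine squeeze_zero (fun _ => Finset.sum_nonneg fun i _ => dist_nonneg) (fun E => ?_) hu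
  refine Finset.sum_le_sum fun i _ => ?_
  rw [dist_eq_norm, dist_eq_norm, ← map_sub]
  exact hL _

theorem MemH1.bounded_clm {u : ℝ → ℂ} (hu : MemH1 u) (L : ℂ →L[ℝ] ℝ) (hL : ∀ z, ‖L z‖ ≤ ‖z‖) :
    ∃ C : ℝ, ∀ x : ℝ, 0 ≤ x → (L (u x)) ^ 2 ≤ C := by
  set p : ℝ → ℝ := fun x => L (u x) with hp
  have hi1 : Integrable (fun x => ‖u x‖ ^ 2) halfLine :=
    (memLp_two_iff_integrable_sq_norm hu.memLp.1).1 hu.memLp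
  have hi2 : Integrable (fun x => ‖deriv u x‖ ^ 2) halfLine :=
    (memLp_two_iff_integrable_sq_norm hu.memLp_deriv.1).1 hu.memLp_deriv
  have hi := hi1.add hi2
  refine ⟨(p 0) ^ 2 + ∫ x in Ioi (0 : ℝ), (‖u x‖ ^ 2 + ‖deriv u x‖ ^ 2), fun b hb => ?_⟩
  have hac : AbsolutelyContinuousOnInterval p 0 b := absCont_clm L hL (hu.absCont b hb)
  have hftc := hac.integral_deriv_mul_eq_sub hac
  have hd : ∀ᵐ x ∂halfLine, deriv p x = L (deriv u x) := by
    filter_upwards [ae_differentiableAt_of_absCont hu.absCont] with x hx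
    exact (L.hasFDerivAt.comp_hasDerivAt x hx.hasDerivAt).deriv
  have hsub : Ioc 0 b ⊆ Ioi (0 : ℝ) := fun x hx => hx.1
  have hle : ∫ x in (0 : ℝ)..b, (deriv p x * p x + p x * deriv p x)
      ≤ ∫ x in Ioc 0 b, (‖u x‖ ^ 2 + ‖deriv u x‖ ^ 2) := by
    rw [intervalIntegral.integral_of_le hb]
    refine integral_mono_ae ?_ (hi.mono_measure (Measure.restrict_mono_set _ hsub)) ?_
    · have := (hac.intervalIntegrable_deriv.mul_continuousOn hac.continuousOn).add
        (hac.intervalIntegrable_deriv.continuousOn_mul hac.continuousOn)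
      exact (intervalIntegrable_iff_integrableOn_Ioc_of_le hb).1 this
    · filter_upwards [ae_restrict_of_ae_restrict_of_subset hsub hd] with x hx
      have h1 : (p x) ^ 2 ≤ ‖u x‖ ^ 2 := by
        rw [← sq_abs (p x)]
        exact pow_le_pow_left₀ (abs_nonneg _) (hL _) 2
      have h2 : (deriv p x) ^ 2 ≤ ‖deriv u x‖ ^ 2 := by
        rw [hx, ← sq_abs]
        exact pow_le_pow_left₀ (abs_nonneg _) (hL _) 2
      nlinarith [sq_nonneg (p x - deriv p x)]
  have hle2 : ∫ x in Ioc 0 b, (‖u x‖ ^ 2 + ‖deriv u x‖ ^ 2)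
      ≤ ∫ x in Ioi (0 : ℝ), (‖u x‖ ^ 2 + ‖deriv u x‖ ^ 2) :=
    setIntegral_mono_set hi (Eventually.of_forall fun x => by positivity)
      (LE.le.eventuallyLE hsub)
  have : p b ^ 2 = p b * p b := sq _
  nlinarith

/-- Elements of `H¹(ℝ₊)` are bounded. -/
theorem MemH1.bounded {u : ℝ → ℂ} (hu : MemH1 u) : ∃ C : ℝ, ∀ x : ℝ, 0 ≤ x → ‖u x‖ ≤ C := by
  obtain ⟨A, hA⟩ := hu.bounded_clm Complex.reCLM (fun z => Complex.abs_re_le_norm z)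
  obtain ⟨B, hB⟩ := hu.bounded_clm Complex.imCLM (fun z => Complex.abs_im_le_norm z)
  refine ⟨√(A + B), fun x hx => Real.le_sqrt_of_sq_le ?_⟩
  have h1 := hA x hx
  have h2 := hB x hx
  simp only [Complex.reCLM_apply, Complex.imCLM_apply] at h1 h2
  rw [← Complex.normSq_eq_norm_sq, Complex.normSq_apply]
  nlinarith

/-- The integrand of the form is integrable, for `V ∈ L₁(ℝ₊)` and arguments in `H¹(ℝ₊)`. -/
theorem form_integrable {V : ℝ → ℝ} (hV : IntegrableOn V (Ioi 0)) {u v : ℝ → ℂ} (hu : MemH1 u)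
    (hv : MemH1 v) :
    Integrable (fun x => deriv u x * starRingEnd ℂ (deriv v x)
      + (V x : ℂ) * u x * starRingEnd ℂ (v x)) halfLine := by
  refine Integrable.add ?_ ?_
  · exact MemLp.integrable_mul hu.memLp_deriv hv.memLp_deriv.star
  · obtain ⟨A, hA⟩ := hu.bounded
    obtain ⟨B, hB⟩ := hv.bounded
    have hV' : Integrable (fun x => (V x : ℂ)) halfLine := hV.ofReal
    refine (hV'.mul_bdd (c := A) hu.memLp.1 ?_).mul_bdd (c := B) hv.memLp.star.1 ?_
    · rw [ae_restrict_iff' measurableSet_Ioi]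
      exact Eventually.of_forall fun x hx => hA x (le_of_lt hx)
    · rw [ae_restrict_iff' measurableSet_Ioi]
      exact Eventually.of_forall fun x hx => by simpa using hB x (le_of_lt hx)

theorem form_add {V : ℝ → ℝ} (hV : IntegrableOn V (Ioi 0)) (γ : ℝ) {u₁ u₂ v : ℝ → ℂ}
    (h₁ : MemH1 u₁) (h₂ : MemH1 u₂) (hv : MemH1 v) :
    form V γ (u₁ + u₂) v = form V γ u₁ v + form V γ u₂ v := by
  have key : (∫ x in Ioi (0 : ℝ), (deriv (u₁ + u₂) x * starRingEnd ℂ (deriv v x)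
      + (V x : ℂ) * (u₁ + u₂) x * starRingEnd ℂ (v x)))
      = (∫ x in Ioi (0 : ℝ), (deriv u₁ x * starRingEnd ℂ (deriv v x)
        + (V x : ℂ) * u₁ x * starRingEnd ℂ (v x)))
      + ∫ x in Ioi (0 : ℝ), (deriv u₂ x * starRingEnd ℂ (deriv v x)
        + (V x : ℂ) * u₂ x * starRingEnd ℂ (v x)) := by
    rw [← integral_add (form_integrable hV h₁ hv) (form_integrable hV h₂ hv)]
    refine integral_congr_ae ?_
    filter_upwards [h₁.deriv_add h₂] with x hx
    rw [hx]
    simp only [Pi.add_apply]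
    ring
  unfold form
  rw [key]
  simp only [Pi.add_apply]
  ring

theorem form_smul (V : ℝ → ℝ) (γ : ℝ) (c : ℂ) (u v : ℝ → ℂ) :
    form V γ (c • u) v = c * form V γ u v := by
  simp only [form, deriv_smul_fun, Pi.smul_apply, smul_eq_mul]
  rw [mul_add, ← integral_const_mul]
  congr 1
  · congr 1
    funext x
    ring
  · ring

/-! ### The operator of the form -/

/-- The graph of the operator associated with the form: pairs `(u, f)` with `u ∈ H¹(ℝ₊)`,
`f ∈ L₂(ℝ₊)` and `form u v = ∫ f v̄` for all `v ∈ H¹(ℝ₊)`. -/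
def hamiltonianGraph (V : ℝ → ℝ) (γ : ℝ) (hV : IntegrableOn V (Ioi 0)) :
    Submodule ℂ (L2 × L2) where
  carrier := {p | ∃ u : ℝ → ℂ, MemH1 u ∧ p.1 =ᵐ[halfLine] u ∧
    ∀ v : ℝ → ℂ, MemH1 v → form V γ u v = ∫ x in Ioi (0 : ℝ), p.2 x * starRingEnd ℂ (v x)}
  zero_mem' := by
    refine ⟨0, memH1_zero, Lp.coeFn_zero _ _ _, fun v _ => ?_⟩
    have h0 : form V γ 0 v = 0 := by simpa using form_smul V γ 0 0 v
    rw [h0, ← integral_zero ℝ ℂ (μ := halfLine)]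
    refine integral_congr_ae ?_
    filter_upwards [Lp.coeFn_zero ℂ 2 halfLine] with x hx
    simp only [Prod.snd_zero]
    rw [hx]
    simp
  add_mem' := by
    rintro p q ⟨u, hu, hpu, hp⟩ ⟨u', hu', hqu, hq⟩
    refine ⟨u + u', hu.add hu', ?_, fun v hv => ?_⟩
    · filter_upwards [Lp.coeFn_add p.1 q.1, hpu, hqu] with x h1 h2 h3
      simp only [Prod.fst_add]
      rw [h1, Pi.add_apply, h2, h3, Pi.add_apply]
    · rw [form_add hV γ hu hu' hv, hp v hv, hq v hv]
      have hi1 : Integrable (fun x => p.2 x * starRingEnd ℂ (v x)) halfLine :=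
        MemLp.integrable_mul (Lp.memLp p.2) hv.memLp.star
      have hi2 : Integrable (fun x => q.2 x * starRingEnd ℂ (v x)) halfLine :=
        MemLp.integrable_mul (Lp.memLp q.2) hv.memLp.star
      rw [← integral_add hi1 hi2]
      refine integral_congr_ae ?_
      filter_upwards [Lp.coeFn_add p.2 q.2] with x hx
      simp only [Prod.snd_add]
      rw [hx, Pi.add_apply]
      ring
  smul_mem' := by
    rintro c p ⟨u, hu, hpu, hp⟩
    refine ⟨c • u, hu.smul c, ?_, fun v hv => ?_⟩
    · filter_upwards [Lp.coeFn_smul c p.1, hpu] with x h1 h2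
      simp only [Prod.smul_fst]
      rw [h1, Pi.smul_apply, h2, Pi.smul_apply]
    · rw [form_smul, hp v hv, ← integral_const_mul]
      refine integral_congr_ae ?_
      filter_upwards [Lp.coeFn_smul c p.2] with x hx
      simp only [Prod.smul_snd]
      rw [hx, Pi.smul_apply, smul_eq_mul]
      ring

/-- Smooth compactly supported functions belong to `H¹(ℝ₊)`. -/
theorem memH1_of_test {g : ℝ → ℝ} (hg : ContDiff ℝ 1 g) (hc : HasCompactSupport g) :
    MemH1 (fun x => (g x : ℂ)) := by
  have hG : ContDiff ℝ 1 (fun x => (g x : ℂ)) := Complex.ofRealCLM.contDiff.comp hg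
  have hC : HasCompactSupport (fun x => (g x : ℂ)) := hc.comp_left Complex.ofReal_zero
  exact
    { absCont := fun b _ => hG.contDiffOn.absolutelyContinuousOnInterval
      memLp := hG.continuous.memLp_of_hasCompactSupport hC
      memLp_deriv := (hG.continuous_deriv le_rfl).memLp_of_hasCompactSupport hC.deriv }

/-- The graph is single valued, so it is the graph of an operator. -/
theorem hamiltonianGraph_single_valued (V : ℝ → ℝ) (γ : ℝ) (hV : IntegrableOn V (Ioi 0))
    (p : L2 × L2) (hp : p ∈ hamiltonianGraph V γ hV) (h0 : p.1 = 0) : p.2 = 0 := by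
  obtain ⟨u, hu, hpu, h⟩ := hp
  have hu0 : ∀ᵐ x ∂halfLine, u x = 0 := by
    filter_upwards [hpu, Lp.coeFn_zero ℂ 2 halfLine] with x h1 h2
    rw [← h1, h0, h2, Pi.zero_apply]
  have hcont : ContinuousOn u (Ioi 0) := fun x hx => by
    have := (hu.absCont (x + 1) (by have : (0 : ℝ) < x := hx; linarith)).continuousOn
    have hx' : (0 : ℝ) < x := hx
    rw [uIcc_of_le (by linarith)] at this
    exact (this.continuousAt (Icc_mem_nhds hx' (by linarith))).continuousWithinAt
  have huz : EqOn u 0 (Ioi 0) :=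
    Measure.eqOn_open_of_ae_eq hu0 isOpen_Ioi hcont continuousOn_const
  have hd0 : ∀ x ∈ Ioi (0 : ℝ), deriv u x = 0 := fun x hx => by
    have : u =ᶠ[𝓝 x] fun _ => 0 := by
      filter_upwards [isOpen_Ioi.mem_nhds hx] with y hy using huz hy
    rw [this.deriv_eq, deriv_const]
  have hint : ∀ g : ℝ → ℝ, ContDiff ℝ (⊤ : ℕ∞) g → HasCompactSupport g → tsupport g ⊆ Ioi 0 →
      ∫ x in Ioi (0 : ℝ), g x • p.2 x = 0 := by
    intro g hg hgc hgs
    have hform := h _ (memH1_of_test (hg.of_le (by exact_mod_cast le_top)) hgc)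
    have hg0 : g 0 = 0 := by
      by_contra hne
      exact lt_irrefl (0 : ℝ) (hgs (subset_tsupport g hne))
    have hL : form V γ u (fun x => (g x : ℂ)) = 0 := by
      unfold form
      rw [setIntegral_congr_fun (g := fun _ => (0 : ℂ)) measurableSet_Ioi
        (fun x hx => by simp [huz hx, hd0 x hx])]
      simp [hg0]
    rw [hL] at hform
    rw [hform]
    refine integral_congr_ae (Eventually.of_forall fun x => ?_)
    simp [mul_comm]
  have hae := isOpen_Ioi.ae_eq_zero_of_integral_contDiff_smul_eq_zero (U := Ioi (0 : ℝ))
    (f := p.2) (μ := halfLine)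
    (((Lp.memLp p.2).locallyIntegrable (by norm_num)).locallyIntegrableOn _) hint
  rw [Lp.eq_zero_iff_ae_eq_zero]
  filter_upwards [hae, ae_restrict_mem measurableSet_Ioi] with x hx hx0 using hx hx0

/-- The Hamiltonian `H = -d²/dx² + V` with boundary condition `u'(0) = γ u(0)` in `L₂(ℝ₊)`: the
operator associated with the quadratic form `form` with form domain `H¹(ℝ₊)`. -/
def hamiltonian (V : ℝ → ℝ) (γ : ℝ) (hV : IntegrableOn V (Ioi 0)) : L2 →ₗ.[ℂ] L2 :=
  (hamiltonianGraph V γ hV).toLinearPMap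

theorem hamiltonian_graph (V : ℝ → ℝ) (γ : ℝ) (hV : IntegrableOn V (Ioi 0)) :
    (hamiltonian V γ hV).graph = hamiltonianGraph V γ hV :=
  Submodule.toLinearPMap_graph_eq _ (hamiltonianGraph_single_valued V γ hV)

/-- `μ` is an eigenvalue of the unbounded operator `T`. -/
def IsEigenvalue {E : Type*} [AddCommGroup E] [Module ℂ E] (T : E →ₗ.[ℂ] E) (μ : ℂ) : Prop :=
  ∃ u : T.domain, (u : E) ≠ 0 ∧ T u = μ • (u : E)

end

end RobinHalfLine

/-!
The eigenvalue problem is reduced to the boundary value `w(ζ) = γ θ(0) - θ'(0)` of the Jost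
solution.

*Existence.* With `θ(x) = e^{iζx} m(x)` and, for the regular solution, `φ(x) = e^{-iζx} n(x)`, the
variation of constants formula becomes a Volterra equation for `m`, and one for `n` after reflecting
the half-line, with the kernel `(e^{2iζs} - 1) / (2iζ)`. This kernel is bounded by `1 / |ζ|` for
`Im ζ ≥ 0`, and `V` is integrable, so the Neumann series converges with factorial speed
(`volterraTerm_props`). Its terms are holomorphic in `ζ`, hence so is `w`
(`analyticAt_jostFunction`). A continuous solution of the variation of constants equation solves the
differential equation (`isSolution_of_variation`). The growth bound on `φ` makes `w` independent of
the choice of the Jost solution (`IsJostSolution.boundary_eq`).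

*Integration by parts.* For a solution `ψ` and a locally absolutely continuous `u`, the integral
of `u' ψ' + (V - z) ψ u` is the increment of `u ψ'` (`IsSolution.integral_eq`). All identities below
are instances of this one.

*Zeros in the upper half-plane.* Lagrange's identity for `θ(·, ζ)` and the conjugate of
`θ(·, ζ₁)` (`jost_lagrange`) reads
`θ(0, ζ) w(ζ₁)* - w(ζ) θ(0, ζ₁)* = (ζ² - (ζ₁²)*) ∫ θ(x, ζ) θ(x, ζ₁)* dx`.
At a zero `ζ = ζ₁` it shows that `ζ²` is real, so that `ζ` is purely imaginary. For a fixed zero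
`ζ`, dividing by `(ζ₁ - ζ)*` and letting `ζ₁ → ζ` gives a nonzero multiple of `∫ |θ|²`, so that
`w'(ζ) ≠ 0` (`deriv_jostFunction_ne_zero`).

*Eigenvalues.* For `Im ζ > 0` the Jost solution belongs to `H¹`, and it satisfies the weak
eigenvalue equation exactly when `w(ζ) = 0` (`form_jost`). Conversely, testing an eigenfunction `u`
against Green's function with pole `y` gives `u(y) w(ζ) = 0` for every `y > 0`
(`jostFunction_mul_eq_zero`). Finally, `w` has no real zeros other than possibly `0`, because the
Wronskian of `θ` and its conjugate is `2iζ` (`jostFunction_ne_zero_of_real`).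
-/

namespace RobinHalfLine

open MeasureTheory Set Filter Topology

noncomputable section

/-! ### Calculus of absolutely continuous complex functions -/

theorem absCont_congr {f g : ℝ → ℂ} {a b : ℝ} (hf : AbsolutelyContinuousOnInterval f a b)
    (h : EqOn f g (uIcc a b)) : AbsolutelyContinuousOnInterval g a b := by
  rw [absolutelyContinuousOnInterval_iff] at hf ⊢
  intro ε hε
  obtain ⟨δ, hδ, H⟩ := hf ε hε
  refine ⟨δ, hδ, fun E hE hl => ?_⟩
  refine lt_of_eq_of_lt (Finset.sum_congr rfl fun i hi => ?_) (H E hE hl)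
  rw [h (hE.1 i hi).1, h (hE.1 i hi).2]

theorem absCont_ofReal {f : ℝ → ℝ} {a b : ℝ} (hf : AbsolutelyContinuousOnInterval f a b) :
    AbsolutelyContinuousOnInterval (fun x => (f x : ℂ)) a b := by
  rw [absolutelyContinuousOnInterval_iff] at hf ⊢
  simpa only [dist_eq_norm, ← Complex.ofReal_sub, Complex.norm_real] using hf

theorem absCont_star {f : ℝ → ℂ} {a b : ℝ} (hf : AbsolutelyContinuousOnInterval f a b) :
    AbsolutelyContinuousOnInterval (fun x => starRingEnd ℂ (f x)) a b := by
  rw [absolutelyContinuousOnInterval_iff] at hf ⊢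
  simpa only [dist_eq_norm, ← map_sub, RCLike.norm_conj] using hf

theorem absCont_mul {f g : ℝ → ℂ} {a b : ℝ} (hf : AbsolutelyContinuousOnInterval f a b)
    (hg : AbsolutelyContinuousOnInterval g a b) :
    AbsolutelyContinuousOnInterval (fun x => f x * g x) a b :=
  hf.smul hg

/-- Primitives of integrable complex functions are absolutely continuous. -/
theorem absCont_primitive {h : ℝ → ℂ} {a b : ℝ} (hh : IntervalIntegrable h volume a b) :
    AbsolutelyContinuousOnInterval (fun x => ∫ t in a..x, h t) a b := by
  have hre : IntervalIntegrable (fun t => (h t).re) volume a b := ⟨hh.1.re, hh.2.re⟩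
  have him : IntervalIntegrable (fun t => (h t).im) volume a b := ⟨hh.1.im, hh.2.im⟩
  have h1 := absCont_ofReal (hre.absolutelyContinuousOnInterval_intervalIntegral left_mem_uIcc)
  have h2 := (absCont_ofReal
    (him.absolutelyContinuousOnInterval_intervalIntegral left_mem_uIcc)).const_smul Complex.I
  refine absCont_congr (h1.add h2) fun x hx => ?_
  have hsub : uIcc a x ⊆ uIcc a b := uIcc_subset_uIcc_left hx
  have hx' : IntervalIntegrable h volume a x := hh.mono_set hsub
  have e1 : ((∫ t in a..x, (h t).re : ℝ) : ℂ) = ((∫ t in a..x, h t).re : ℂ) := by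
    have := Complex.reCLM.intervalIntegral_comp_comm hx'
    simp only [Complex.reCLM_apply] at this
    rw [this]
  have e2 : ((∫ t in a..x, (h t).im : ℝ) : ℂ) = ((∫ t in a..x, h t).im : ℂ) := by
    have := Complex.imCLM.intervalIntegral_comp_comm hx'
    simp only [Complex.imCLM_apply] at this
    rw [this]
  simp only [Pi.add_apply, smul_eq_mul]
  rw [e1, e2, mul_comm, Complex.re_add_im]

/-- The fundamental theorem of calculus for an absolutely continuous complex function. -/
theorem absCont_integral_eq_sub {f f' : ℝ → ℂ} {a b : ℝ}
    (hf : AbsolutelyContinuousOnInterval f a b) (hi : IntervalIntegrable f' volume a b)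
    (hd : ∀ᵐ x, x ∈ uIcc a b → HasDerivAt f (f' x) x) :
    ∫ x in a..b, f' x = f b - f a := by
  have h0 : ∀ᵐ x, x ∈ uIcc a b → HasDerivAt (f - fun x => ∫ t in a..x, f' t) 0 x := by
    filter_upwards [hd, hi.ae_hasDerivAt_integral] with x h1 h2 hx
    simpa using (h1 hx).sub (h2 hx a left_mem_uIcc)
  obtain ⟨C, hC⟩ := (hf.sub (absCont_primitive hi)).const_of_ae_hasDerivAt_zero h0
  have ha := hC a left_mem_uIcc
  have hb := hC b right_mem_uIcc
  simp only [Pi.sub_apply, intervalIntegral.integral_same, sub_zero] at ha hb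
  rw [ha, ← hb]
  ring

theorem absCont_intervalIntegrable_deriv {u : ℝ → ℂ} {b : ℝ} (hb : 0 ≤ b)
    (hu : ∀ b : ℝ, 0 ≤ b → AbsolutelyContinuousOnInterval u 0 b) :
    IntervalIntegrable (deriv u) volume 0 b := by
  have h1 := (absCont_clm Complex.reCLM (fun z => Complex.abs_re_le_norm z)
    (hu b hb)).intervalIntegrable_deriv
  have h2 := (absCont_clm Complex.imCLM (fun z => Complex.abs_im_le_norm z)
    (hu b hb)).intervalIntegrable_deriv
  rw [intervalIntegrable_iff_integrableOn_Ioc_of_le hb] at h1 h2 ⊢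
  have h3 := (h1.ofReal (𝕜 := ℂ)).add ((h2.ofReal (𝕜 := ℂ)).const_mul Complex.I)
  refine h3.congr ?_
  have hsub : Ioc 0 b ⊆ Ioi (0 : ℝ) := fun x hx => hx.1
  filter_upwards [ae_restrict_of_ae_restrict_of_subset hsub (ae_differentiableAt_of_absCont hu)]
    with x hx
  have e1 := (Complex.reCLM.hasFDerivAt.comp_hasDerivAt x hx.hasDerivAt).deriv
  have e2 := (Complex.imCLM.hasFDerivAt.comp_hasDerivAt x hx.hasDerivAt).deriv
  simp only [Function.comp_def] at e1 e2
  simp only [Pi.add_apply]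
  rw [e1, e2]
  simp only [Complex.reCLM_apply, Complex.imCLM_apply]
  rw [mul_comm]
  exact Complex.re_add_im _

theorem ae_uIcc_of_ae_halfLine {P : ℝ → Prop} (h : ∀ᵐ x ∂halfLine, P x) {a b : ℝ} (ha : 0 ≤ a)
    (hb : 0 ≤ b) : ∀ᵐ x, x ∈ uIcc a b → P x := by
  rw [ae_restrict_iff' measurableSet_Ioi] at h
  have h0 : ∀ᵐ x : ℝ, x ≠ 0 := by simp [ae_iff, measure_singleton]
  filter_upwards [h, h0] with x hx hx0 hxm
  exact hx (lt_of_le_of_ne ((le_min ha hb).trans hxm.1) hx0.symm)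

theorem continuousOn_of_absCont {u : ℝ → ℂ}
    (hu : ∀ b : ℝ, 0 ≤ b → AbsolutelyContinuousOnInterval u 0 b) : ContinuousOn u (Ioi 0) :=
  fun x hx => by
    have hx' : (0 : ℝ) < x := hx
    have := (hu (x + 1) (by linarith)).continuousOn
    rw [uIcc_of_le (by linarith)] at this
    exact (this.continuousAt (Icc_mem_nhds hx' (by linarith))).continuousWithinAt

/-! ### Solutions of the differential equation -/

theorem IsSolution.hasDerivWithinAt {V : ℝ → ℝ} {z : ℂ} {u : ℝ → ℂ} (hu : IsSolution V z u)
    {x : ℝ} (hx : 0 ≤ x) : HasDerivWithinAt u (hderiv u x) (Ici 0) x :=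
  ((hu.contDiffOn.differentiableOn (by norm_num)) x hx).hasDerivWithinAt

theorem IsSolution.hasDerivAt {V : ℝ → ℝ} {z : ℂ} {u : ℝ → ℂ} (hu : IsSolution V z u)
    {x : ℝ} (hx : 0 < x) : HasDerivAt u (hderiv u x) x :=
  (hu.hasDerivWithinAt hx.le).hasDerivAt (Ici_mem_nhds hx)

theorem IsSolution.continuousOn {V : ℝ → ℝ} {z : ℂ} {u : ℝ → ℂ} (hu : IsSolution V z u) :
    ContinuousOn u (Ici 0) := hu.contDiffOn.continuousOn

theorem IsSolution.continuousOn_hderiv {V : ℝ → ℝ} {z : ℂ} {u : ℝ → ℂ} (hu : IsSolution V z u) :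
    ContinuousOn (hderiv u) (Ici 0) :=
  hu.contDiffOn.continuousOn_derivWithin (uniqueDiffOn_Ici 0) le_rfl

theorem IsSolution.absCont_self {V : ℝ → ℝ} {z : ℂ} {u : ℝ → ℂ} (hu : IsSolution V z u)
    (b : ℝ) (hb : 0 ≤ b) : AbsolutelyContinuousOnInterval u 0 b :=
  (hu.contDiffOn.mono
    (by rw [uIcc_of_le hb]; exact fun x hx => hx.1)).absolutelyContinuousOnInterval

/-- A locally absolutely continuous solution of the first order system `u' = p`,
`p' = (V - z) u` is a solution of the second order equation, with derivative `p`. -/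
theorem isSolution_of_system {V : ℝ → ℝ} {z : ℂ} {u p : ℝ → ℂ}
    (hu : ∀ b : ℝ, 0 ≤ b → AbsolutelyContinuousOnInterval u 0 b)
    (hp : ∀ b : ℝ, 0 ≤ b → AbsolutelyContinuousOnInterval p 0 b)
    (hup : ∀ᵐ x ∂halfLine, HasDerivAt u (p x) x)
    (hpu : ∀ᵐ x ∂halfLine, HasDerivAt p (((V x : ℂ) - z) * u x) x) :
    IsSolution V z u ∧ ∀ x : ℝ, 0 ≤ x → hderiv u x = p x := by
  -- The extension of `p` by its value at `0` is continuous on the whole line, so that its primitive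
  -- is differentiable everywhere.
  have hpc : Continuous (fun x => p (max x 0)) := by
    rw [continuous_iff_continuousAt]
    intro x
    have h1 : ContinuousOn p (Icc 0 (max x 0 + 1)) := by
      have := (hp (max x 0 + 1) (by positivity)).continuousOn
      rwa [uIcc_of_le (by positivity)] at this
    have h2 : ContinuousOn (fun x => p (max x 0)) (Iio (max x 0 + 1)) :=
      h1.comp (by fun_prop) fun y hy => ⟨le_max_right _ _, by
        have : y < max x 0 + 1 := hy
        have h3 : (0 : ℝ) ≤ max x 0 := le_max_right _ _
        exact max_le this.le (by linarith)⟩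
    exact h2.continuousAt (Iio_mem_nhds (by linarith [le_max_left x 0]))
  have hform : ∀ x : ℝ, 0 ≤ x → u x = u 0 + ∫ t in (0 : ℝ)..x, p (max t 0) := fun x hx => by
    have := absCont_integral_eq_sub (hu x hx) (f' := fun t => p (max t 0))
      (hpc.intervalIntegrable _ _) (by
        filter_upwards [ae_uIcc_of_ae_halfLine hup le_rfl hx] with y hy hym
        rw [uIcc_of_le hx] at hym
        rw [max_eq_left hym.1]
        exact hy (by rwa [uIcc_of_le hx]))
    rw [this]
    ring
  have hder : ∀ x : ℝ, 0 ≤ x → HasDerivWithinAt u (p x) (Ici 0) x := fun x hx => by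
    have h1 : HasDerivAt (fun x => u 0 + ∫ t in (0 : ℝ)..x, p (max t 0)) (p (max x 0)) x :=
      (intervalIntegral.integral_hasDerivAt_right (hpc.intervalIntegrable _ _)
        (hpc.stronglyMeasurableAtFilter _ _) hpc.continuousAt).const_add _
    rw [max_eq_left hx] at h1
    exact h1.hasDerivWithinAt.congr (fun y hy => hform y hy) (hform x hx)
  have hhd : ∀ x : ℝ, 0 ≤ x → hderiv u x = p x := fun x hx =>
    (hder x hx).derivWithin (uniqueDiffOn_Ici 0 x hx)
  refine ⟨⟨?_, fun b hb => ?_, ?_⟩, hhd⟩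
  · rw [show (1 : WithTop ℕ∞) = 0 + 1 by simp,
      contDiffOn_succ_iff_derivWithin (uniqueDiffOn_Ici 0)]
    refine ⟨fun x hx => (hder x hx).differentiableWithinAt, by simp, ?_⟩
    rw [contDiffOn_zero]
    refine hpc.continuousOn.congr fun x hx => (hhd x hx).trans ?_
    exact congrArg p (max_eq_left (mem_Ici.1 hx)).symm
  · refine absCont_congr (hp b hb) fun x hx => ?_
    rw [uIcc_of_le hb] at hx
    exact (hhd x hx.1).symm
  · filter_upwards [hpu, ae_restrict_mem measurableSet_Ioi] with x hx hx0
    refine hx.congr_of_eventuallyEq ?_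
    filter_upwards [Ioi_mem_nhds hx0] with y hy using hhd y (le_of_lt hy)

theorem intervalIntegrable_potential_mul {V : ℝ → ℝ} (hV : IntegrableOn V (Ioi 0)) {g : ℝ → ℂ}
    {a b : ℝ} (ha : 0 ≤ a) (hab : a ≤ b) (hg : ContinuousOn g (uIcc a b)) :
    IntervalIntegrable (fun x => (V x : ℂ) * g x) volume a b := by
  refine IntervalIntegrable.mul_continuousOn ?_ hg
  rw [intervalIntegrable_iff_integrableOn_Ioc_of_le hab]
  exact (hV.mono_set fun x hx => lt_of_le_of_lt ha hx.1).ofReal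

/-- Integration by parts: the form of `-d²/dx² + V - z` on `[a, b]`, with a solution as one of its
arguments, reduces to boundary terms. -/
theorem IsSolution.integral_eq {V : ℝ → ℝ} (hV : IntegrableOn V (Ioi 0)) {z : ℂ} {u ψ : ℝ → ℂ}
    (hu : ∀ b : ℝ, 0 ≤ b → AbsolutelyContinuousOnInterval u 0 b) (hψ : IsSolution V z ψ)
    {a b : ℝ} (ha : 0 ≤ a) (hab : a ≤ b) :
    IntervalIntegrable (fun x => deriv u x * hderiv ψ x + ((V x : ℂ) - z) * ψ x * u x) volume a b ∧
    ∫ x in a..b, (deriv u x * hderiv ψ x + ((V x : ℂ) - z) * ψ x * u x)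
      = u b * hderiv ψ b - u a * hderiv ψ a := by
  have hb := ha.trans hab
  have hsub : uIcc a b ⊆ uIcc 0 b := by
    rw [uIcc_of_le hab, uIcc_of_le hb]; exact Icc_subset_Icc_left ha
  have hsub' : uIcc a b ⊆ Ici 0 := by
    rw [uIcc_of_le hab]; exact fun x hx => ha.trans hx.1
  have hac := (absCont_mul (hu b hb) (hψ.absCont b hb)).mono hsub
  have huc := (hu b hb).continuousOn.mono hsub
  have hi : IntervalIntegrable
      (fun x => deriv u x * hderiv ψ x + ((V x : ℂ) - z) * ψ x * u x) volume a b := by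
    refine (((absCont_intervalIntegrable_deriv hb hu).mono_set hsub).mul_continuousOn
      (hψ.continuousOn_hderiv.mono hsub')).add ?_
    have hc : ContinuousOn (fun x => ψ x * u x) (uIcc a b) :=
      (hψ.continuousOn.mono hsub').mul huc
    have h1 := (intervalIntegrable_potential_mul hV ha hab hc).sub
      (hc.const_mul z).intervalIntegrable
    refine h1.congr (fun x _ => ?_)
    ring
  refine ⟨hi, absCont_integral_eq_sub hac hi ?_⟩
  filter_upwards [ae_uIcc_of_ae_halfLine (ae_differentiableAt_of_absCont hu) ha hb,
    ae_uIcc_of_ae_halfLine hψ.equation ha hb] with x h1 h2 hx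
  convert! (h1 hx).hasDerivAt.mul (h2 hx) using 1
  ring

/-- **Lagrange's identity** for two solutions at the spectral parameters `z₁` and `z₂`. -/
theorem wronskian_sub {V : ℝ → ℝ} (hV : IntegrableOn V (Ioi 0)) {z₁ z₂ : ℂ} {u v : ℝ → ℂ}
    (hu : IsSolution V z₁ u) (hv : IsSolution V z₂ v) {a b : ℝ} (ha : 0 ≤ a) (hab : a ≤ b) :
    wronskian u v b - wronskian u v a = (z₂ - z₁) * ∫ x in a..b, u x * v x := by
  obtain ⟨i1, e1⟩ := hu.integral_eq hV hv.absCont_self ha hab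
  obtain ⟨i2, e2⟩ := hv.integral_eq hV hu.absCont_self ha hab
  have h := intervalIntegral.integral_sub i1 i2
  rw [e1, e2] at h
  rw [← intervalIntegral.integral_const_mul]
  unfold wronskian
  have h2 : ∫ x in a..b, ((deriv v x * hderiv u x + ((V x : ℂ) - z₁) * u x * v x)
      - (deriv u x * hderiv v x + ((V x : ℂ) - z₂) * v x * u x))
      = ∫ x in a..b, (z₂ - z₁) * (u x * v x) := by
    refine intervalIntegral.integral_congr_ae ?_
    refine Eventually.of_forall fun x hx => ?_
    rw [uIoc_of_le hab] at hx
    have hx0 : 0 < x := lt_of_le_of_lt ha hx.1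
    rw [(hu.hasDerivAt hx0).deriv, (hv.hasDerivAt hx0).deriv]
    ring
  rw [← h2, h]
  ring

theorem wronskian_eq {V : ℝ → ℝ} (hV : IntegrableOn V (Ioi 0)) {z : ℂ} {u v : ℝ → ℂ}
    (hu : IsSolution V z u) (hv : IsSolution V z v) {x : ℝ} (hx : 0 ≤ x) :
    wronskian u v x = wronskian u v 0 := by
  have := wronskian_sub hV hu hv le_rfl hx
  simpa [sub_eq_zero] using this

theorem hderiv_star (u : ℝ → ℂ) (x : ℝ) :
    hderiv (fun x => starRingEnd ℂ (u x)) x = starRingEnd ℂ (hderiv u x) := by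
  exact derivWithin.star

theorem IsSolution.star {V : ℝ → ℝ} {z : ℂ} {u : ℝ → ℂ} (hu : IsSolution V z u) :
    IsSolution V (starRingEnd ℂ z) (fun x => starRingEnd ℂ (u x)) where
  contDiffOn := Complex.conjCLE.contDiff.comp_contDiffOn hu.contDiffOn
  absCont b hb := by
    simp only [funext (hderiv_star u)]
    exact absCont_star (hu.absCont b hb)
  equation := by
    filter_upwards [hu.equation] with x hx
    rw [funext (hderiv_star u)]
    have := hx.star
    simpa using! this

/-! ### Volterra integral equations with an integrable weight -/

/-- The tail `∫_x^∞ |W|` of the weight. -/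
def tail (W : ℝ → ℝ) (x : ℝ) : ℝ := ∫ t in Ioi x, |W t|

theorem tail_nonneg (W : ℝ → ℝ) (x : ℝ) : 0 ≤ tail W x :=
  integral_nonneg fun _ => abs_nonneg _

theorem tail_eq_sub {W : ℝ → ℝ} (hW : Integrable W) (x : ℝ) :
    tail W x = tail W 0 - ∫ t in (0 : ℝ)..x, |W t| := by
  rw [intervalIntegral.integral_Ioi_sub_Ioi' hW.abs.integrableOn hW.abs.integrableOn |>.symm]
  simp [tail]

theorem tail_antitone {W : ℝ → ℝ} (hW : Integrable W) : Antitone (tail W) := fun _ _ hxy =>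
  setIntegral_mono_set hW.abs.integrableOn (Eventually.of_forall fun _ => abs_nonneg _)
    (LE.le.eventuallyLE (Ioi_subset_Ioi hxy))

theorem tail_le_integral {W : ℝ → ℝ} (hW : Integrable W) (x : ℝ) : tail W x ≤ ∫ t, |W t| :=
  setIntegral_le_integral hW.abs (Eventually.of_forall fun _ => abs_nonneg _)

/-- The estimate behind the factorial decay of the iterates of a Volterra operator. -/
theorem integral_abs_mul_tail_pow_le {W : ℝ → ℝ} (hW : Integrable W) (n : ℕ) (x : ℝ) :
    IntegrableOn (fun t => |W t| * tail W t ^ n) (Ioi x) ∧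
    ∫ t in Ioi x, |W t| * tail W t ^ n ≤ tail W x ^ (n + 1) / (n + 1) := by
  have hint : Integrable (fun t => |W t| * tail W t ^ n) := by
    refine hW.abs.mul_bdd (c := (∫ t, |W t|) ^ n)
      ((tail_antitone hW).measurable.pow_const n).aestronglyMeasurable
      (Eventually.of_forall fun t => ?_)
    rw [norm_pow, Real.norm_of_nonneg (tail_nonneg W t)]
    exact pow_le_pow_left₀ (tail_nonneg W t) (tail_le_integral hW t) n
  refine ⟨hint.integrableOn, ?_⟩
  have hlim := intervalIntegral_tendsto_integral_Ioi x hint.integrableOn tendsto_id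
  refine le_of_tendsto hlim ?_
  filter_upwards [eventually_ge_atTop x] with b hb
  set F : ℝ → ℝ := fun t => -(tail W t ^ (n + 1) / (n + 1)) with hF
  have hn : (0 : ℝ) < n + 1 := by positivity
  have hmono : MonotoneOn F (uIcc x b) := fun s _ t _ hst => by
    simp only [hF]
    have := pow_le_pow_left₀ (tail_nonneg W t) (tail_antitone hW hst) (n + 1)
    gcongr
  have hder : ∀ᵐ t : ℝ, deriv F t = |W t| * tail W t ^ n := by
    filter_upwards [LocallyIntegrable.ae_hasDerivAt_integral hW.abs.locallyIntegrable] with t ht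
    have h1 : HasDerivAt (tail W) (-|W t|) t := by
      rw [funext (tail_eq_sub hW)]
      exact (ht 0).const_sub _
    have h2 := ((h1.pow (n + 1)).div_const (n + 1 : ℝ)).neg
    rw [hF]
    refine HasDerivAt.deriv ?_
    convert! h2 using 1
    push_cast
    field_simp
  have h := hmono.intervalIntegral_deriv_mem_uIcc
  rw [intervalIntegral.integral_congr_ae (g := fun t => |W t| * tail W t ^ n)
    (by filter_upwards [hder] with t ht _ using ht)] at h
  have hFxb : F x ≤ F b := hmono left_mem_uIcc right_mem_uIcc hb
  rw [uIcc_of_le (by linarith)] at h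
  have hFb : F b ≤ 0 := by
    have := pow_nonneg (tail_nonneg W b) (n + 1)
    simp only [hF]
    have := div_nonneg this hn.le
    linarith
  have := h.2
  simp only [id]
  have hFx : F x = -(tail W x ^ (n + 1) / (n + 1)) := rfl
  linarith

/-- The convolution kernel `k (t - x)` of a Volterra operator: continuous, bounded by `C`, and
supported in `x < t`. -/
structure IsVolterraKernel (k : ℝ → ℂ) (C : ℝ) : Prop where
  continuous : Continuous k
  support : ∀ s, s ≤ 0 → k s = 0
  bound : ∀ s, ‖k s‖ ≤ C

/-- The terms of the Neumann series of `f(x) = g(x) + ∫ k(t - x) W(t) f(t) dt`. -/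
def volterraTerm (k : ℝ → ℂ) (W : ℝ → ℝ) (g : ℝ → ℂ) : ℕ → ℝ → ℂ
  | 0 => g
  | n + 1 => fun x => ∫ t, k (t - x) * (W t : ℂ) * volterraTerm k W g n t

/-- The Neumann series of the Volterra equation `f(x) = g(x) + ∫ k(t - x) W(t) f(t) dt`. -/
def volterraSum (k : ℝ → ℂ) (W : ℝ → ℝ) (g : ℝ → ℂ) (x : ℝ) : ℂ := ∑' n, volterraTerm k W g n x

section Volterra

variable {k : ℝ → ℂ} {C : ℝ} {W : ℝ → ℝ} {g : ℝ → ℂ} {G : ℝ}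

theorem IsVolterraKernel.nonneg (hk : IsVolterraKernel k C) : 0 ≤ C :=
  (norm_nonneg _).trans (hk.bound 0)

theorem IsVolterraKernel.norm_integrand_le (hk : IsVolterraKernel k C) {f : ℝ → ℂ} {B : ℝ}
    (hf : ∀ t, ‖f t‖ ≤ B) (x t : ℝ) : ‖k (t - x) * (W t : ℂ) * f t‖ ≤ C * |W t| * B := by
  rw [norm_mul, norm_mul, Complex.norm_real, Real.norm_eq_abs]
  have := hk.nonneg
  gcongr
  · exact hk.bound _
  · exact hf t

theorem IsVolterraKernel.integrable_integrand (hk : IsVolterraKernel k C) (hW : Integrable W)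
    {f : ℝ → ℂ} (hfc : Continuous f) {B : ℝ} (hf : ∀ t, ‖f t‖ ≤ B) (x : ℝ) :
    Integrable (fun t => k (t - x) * (W t : ℂ) * f t) := by
  refine ((hW.abs.const_mul C).mul_const B).mono' ?_
    (Eventually.of_forall (hk.norm_integrand_le hf x))
  exact ((hk.continuous.comp (by fun_prop)).aestronglyMeasurable.mul
    hW.ofReal.aestronglyMeasurable).mul hfc.aestronglyMeasurable

theorem IsVolterraKernel.continuous_integral (hk : IsVolterraKernel k C) (hW : Integrable W)
    {f : ℝ → ℂ} (hfc : Continuous f) {B : ℝ} (hf : ∀ t, ‖f t‖ ≤ B) :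
    Continuous (fun x => ∫ t, k (t - x) * (W t : ℂ) * f t) := by
  refine continuous_of_dominated (bound := fun t => C * |W t| * B)
    (fun x => (hk.integrable_integrand hW hfc hf x).aestronglyMeasurable)
    (fun x => Eventually.of_forall (hk.norm_integrand_le hf x))
    ((hW.abs.const_mul C).mul_const B) (Eventually.of_forall fun t => ?_)
  have := hk.continuous
  fun_prop

theorem volterraTerm_bound_le (hk : IsVolterraKernel k C) (hW : Integrable W) (hG : 0 ≤ G)
    (n : ℕ) (x : ℝ) : G * (C ^ n * tail W x ^ n / n.factorial)
      ≤ G * ((C * ∫ t, |W t|) ^ n / n.factorial) := by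
  rw [← mul_pow]
  have := hk.nonneg
  have := tail_nonneg W x
  have := tail_le_integral hW x
  gcongr

/-- The terms of the Neumann series decay like `(C ∫_x^∞ |W|)^n / n!`. Their continuity, which
makes the next integrand measurable, is part of the induction. -/
theorem volterraTerm_props (hk : IsVolterraKernel k C) (hW : Integrable W) (hgc : Continuous g)
    (hg : ∀ x, ‖g x‖ ≤ G) (n : ℕ) : Continuous (volterraTerm k W g n) ∧
      ∀ x, ‖volterraTerm k W g n x‖ ≤ G * (C ^ n * tail W x ^ n / n.factorial) := by
  have hG : 0 ≤ G := (norm_nonneg _).trans (hg 0)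
  induction n with
  | zero => exact ⟨hgc, fun x => by simpa [volterraTerm] using hg x⟩
  | succ n ih =>
    obtain ⟨hc, hb⟩ := ih
    have hb' := fun x => (hb x).trans (volterraTerm_bound_le hk hW hG n x)
    refine ⟨hk.continuous_integral hW hc hb', fun x => ?_⟩
    have hC := hk.nonneg
    obtain ⟨hi, hle⟩ := integral_abs_mul_tail_pow_le hW n x
    have h1 : ‖volterraTerm k W g (n + 1) x‖
        ≤ ∫ t, (Ioi x).indicator
          (fun t => (G * C ^ (n + 1) / n.factorial) * (|W t| * tail W t ^ n)) t := by
      refine norm_integral_le_of_norm_le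
        (IntegrableOn.integrable_indicator (hi.const_mul _) measurableSet_Ioi)
        (Eventually.of_forall fun t => ?_)
      by_cases ht : t ∈ Ioi x
      · rw [indicator_of_mem ht, norm_mul, norm_mul, Complex.norm_real, Real.norm_eq_abs]
        calc ‖k (t - x)‖ * |W t| * ‖volterraTerm k W g n t‖
            ≤ C * |W t| * (G * (C ^ n * tail W t ^ n / n.factorial)) := by
              gcongr
              · exact hk.bound _
              · exact hb t
          _ = _ := by ring
      · rw [indicator_of_notMem ht, hk.support _ (by simpa using ht)]
        simp
    rw [integral_indicator measurableSet_Ioi, integral_const_mul] at h1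
    refine h1.trans ((mul_le_mul_of_nonneg_left hle (by positivity)).trans (le_of_eq ?_))
    rw [Nat.factorial_succ]
    push_cast
    field_simp

theorem norm_volterraTerm_le (hk : IsVolterraKernel k C) (hW : Integrable W) (hgc : Continuous g)
    (hg : ∀ x, ‖g x‖ ≤ G) (n : ℕ) (x : ℝ) :
    ‖volterraTerm k W g n x‖ ≤ G * ((C * ∫ t, |W t|) ^ n / n.factorial) :=
  ((volterraTerm_props hk hW hgc hg n).2 x).trans
    (volterraTerm_bound_le hk hW ((norm_nonneg _).trans (hg 0)) n x)

theorem summable_volterra_bound (A G : ℝ) : Summable fun n : ℕ => G * (A ^ n / n.factorial) :=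
  (Real.summable_pow_div_factorial A).mul_left G

theorem continuous_volterraSum (hk : IsVolterraKernel k C) (hW : Integrable W)
    (hgc : Continuous g) (hg : ∀ x, ‖g x‖ ≤ G) : Continuous (volterraSum k W g) :=
  continuous_tsum (fun n => (volterraTerm_props hk hW hgc hg n).1) (summable_volterra_bound _ G)
    (norm_volterraTerm_le hk hW hgc hg)

theorem norm_volterraSum_le (hk : IsVolterraKernel k C) (hW : Integrable W)
    (hgc : Continuous g) (hg : ∀ x, ‖g x‖ ≤ G) (x : ℝ) :
    ‖volterraSum k W g x‖ ≤ G * Real.exp (C * ∫ t, |W t|) := by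
  refine tsum_of_norm_bounded ?_ (fun n => norm_volterraTerm_le hk hW hgc hg n x)
  rw [Real.exp_eq_exp_ℝ]
  exact (NormedSpace.expSeries_div_hasSum_exp (C * ∫ t, |W t|)).mul_left G

theorem volterraSum_eq (hk : IsVolterraKernel k C) (hW : Integrable W)
    (hgc : Continuous g) (hg : ∀ x, ‖g x‖ ≤ G) (x : ℝ) :
    volterraSum k W g x = g x + ∫ t, k (t - x) * (W t : ℂ) * volterraSum k W g t := by
  have hsum : ∀ x, Summable fun n => volterraTerm k W g n x := fun x =>
    .of_norm_bounded (summable_volterra_bound _ G) fun n => norm_volterraTerm_le hk hW hgc hg n x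
  unfold volterraSum
  rw [(hsum x).tsum_eq_zero_add]
  congr 1
  have hint : ∀ n, Integrable fun t => k (t - x) * (W t : ℂ) * volterraTerm k W g n t := fun n =>
    hk.integrable_integrand hW (volterraTerm_props hk hW hgc hg n).1
      (norm_volterraTerm_le hk hW hgc hg n) x
  have h := hasSum_integral_of_summable_integral_norm hint ?_
  · rw [show (∑' n, volterraTerm k W g (n + 1) x)
      = ∑' n, ∫ t, k (t - x) * (W t : ℂ) * volterraTerm k W g n t from rfl, h.tsum_eq]
    refine integral_congr_ae (Eventually.of_forall fun t => ?_)
    exact tsum_mul_left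
  · refine Summable.of_nonneg_of_le (fun n => integral_nonneg fun _ => norm_nonneg _) (fun n => ?_)
      ((summable_volterra_bound (C * ∫ t, |W t|) G).mul_left (∫ t, C * |W t|))
    rw [← integral_mul_const]
    exact integral_mono (hint n).norm ((hW.abs.const_mul C).mul_const _)
      (hk.norm_integrand_le (norm_volterraTerm_le hk hW hgc hg n) x)

end Volterra

/-- A dominated integral of holomorphic functions is holomorphic. -/
theorem differentiableOn_integral_of_dominated {U : Set ℂ} (hU : IsOpen U) {F : ℂ → ℝ → ℂ}
    {bound : ℝ → ℝ} (hm : ∀ ζ ∈ U, AEStronglyMeasurable (F ζ) volume)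
    (hd : ∀ t, DifferentiableOn ℂ (fun ζ => F ζ t) U) (hb : ∀ ζ ∈ U, ∀ t, ‖F ζ t‖ ≤ bound t)
    (hbi : Integrable bound) : DifferentiableOn ℂ (fun ζ => ∫ t, F ζ t) U := by
  intro ζ₀ hζ₀
  obtain ⟨ε, hε, hball⟩ := Metric.isOpen_iff.1 hU ζ₀ hζ₀
  set r := ε / 2 with hr
  have hr0 : 0 < r := by positivity
  have hsub : ∀ ζ ∈ Metric.ball ζ₀ r, Metric.closedBall ζ r ⊆ U := fun ζ hζ w hw => by
    refine hball ?_
    rw [Metric.mem_ball] at hζ ⊢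
    rw [Metric.mem_closedBall] at hw
    linarith [dist_triangle w ζ ζ₀]
  have hdiff : ∀ ζ ∈ U, ∀ t, HasDerivAt (fun ζ => F ζ t) (deriv (fun ζ => F ζ t) ζ) ζ :=
    fun ζ hζ t => ((hd t).differentiableAt (hU.mem_nhds hζ)).hasDerivAt
  have hmeas : AEStronglyMeasurable (fun t => deriv (fun ζ => F ζ t) ζ₀) volume := by
    -- The derivative is a pointwise limit of difference quotients along a sequence of steps.
    set h : ℕ → ℂ := fun n => (r : ℂ) * (1 / ((n : ℂ) + 2)) with hh
    have hhn : ∀ n, ζ₀ + h n ∈ U := fun n => by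
      refine hsub ζ₀ (Metric.mem_ball_self hr0) ?_
      rw [Metric.mem_closedBall, dist_eq_norm, add_sub_cancel_left]
      simp only [hh]
      rw [norm_mul, Complex.norm_real, Real.norm_of_nonneg hr0.le, norm_div, norm_one]
      have h2 : ‖(n : ℂ) + 2‖ = (n : ℝ) + 2 := by
        rw [show (n : ℂ) + 2 = (((n : ℝ) + 2 : ℝ) : ℂ) by push_cast; ring, Complex.norm_real,
          Real.norm_of_nonneg (by positivity)]
      rw [h2]
      refine mul_le_of_le_one_right hr0.le ?_
      rw [div_le_one (by positivity)]
      linarith [(Nat.cast_nonneg n : (0 : ℝ) ≤ n)]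
    have hlim : Tendsto h atTop (𝓝[≠] 0) := by
      refine tendsto_nhdsWithin_iff.2 ⟨?_, Eventually.of_forall fun n => ?_⟩
      · have h1 : Tendsto (fun n : ℕ => 1 / ((n : ℂ) + 2)) atTop (𝓝 0) := by
          have := (tendsto_add_atTop_iff_nat 1).2 (tendsto_one_div_add_atTop_nhds_zero_nat (𝕜 := ℂ))
          refine this.congr fun n => ?_
          push_cast
          ring_nf
        simpa [hh] using h1.const_mul (r : ℂ)
      · have h2 : (n : ℂ) + 2 ≠ 0 := by
          have : ((n + 2 : ℕ) : ℂ) ≠ 0 := Nat.cast_ne_zero.2 (by omega)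
          simpa using this
        have h3 : (r : ℂ) ≠ 0 := Complex.ofReal_ne_zero.2 hr0.ne'
        simp only [hh, mem_compl_iff, mem_singleton_iff]
        exact mul_ne_zero h3 (one_div_ne_zero h2)
    refine aestronglyMeasurable_of_tendsto_ae atTop
      (f := fun n t => (h n)⁻¹ • (F (ζ₀ + h n) t - F ζ₀ t))
      (fun n => ((hm _ (hhn n)).sub (hm _ hζ₀)).const_smul (h n)⁻¹)
      (Eventually.of_forall fun t => ?_)
    exact ((hdiff ζ₀ hζ₀ t).tendsto_slope_zero).comp hlim
  refine (hasDerivAt_integral_of_dominated_loc_of_deriv_le (𝕜 := ℂ) (μ := volume)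
    (bound := fun t => bound t / r)
    (F' := fun ζ t => deriv (fun ζ => F ζ t) ζ) (Metric.ball_mem_nhds ζ₀ hr0) ?_ ?_ hmeas ?_ ?_
    ?_).2.differentiableAt.differentiableWithinAt
  · filter_upwards [hU.mem_nhds hζ₀] with ζ hζ using hm ζ hζ
  · exact hbi.mono' (hm ζ₀ hζ₀) (Eventually.of_forall (hb ζ₀ hζ₀))
  · refine Eventually.of_forall fun t ζ hζ => ?_
    refine Complex.norm_deriv_le_of_forall_mem_sphere_norm_le hr0 ?_ fun w hw =>
      hb w (hsub ζ hζ (Metric.sphere_subset_closedBall hw)) t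
    refine DifferentiableOn.diffContOnCl ((hd t).mono ?_)
    exact Metric.closure_ball_subset_closedBall.trans (hsub ζ hζ)
  · exact hbi.div_const r
  · exact Eventually.of_forall fun t ζ hζ =>
      hdiff ζ (hsub ζ hζ (Metric.mem_closedBall_self hr0.le)) t

/-- The Neumann series depends holomorphically on parameters of the kernel and the free term. -/
theorem differentiableOn_volterraSum {U : Set ℂ} (hU : IsOpen U) {k : ℂ → ℝ → ℂ} {C : ℝ}
    {W : ℝ → ℝ} {g : ℂ → ℝ → ℂ} {G : ℝ} (hW : Integrable W)
    (hk : ∀ ζ ∈ U, IsVolterraKernel (k ζ) C) (hgc : ∀ ζ ∈ U, Continuous (g ζ))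
    (hg : ∀ ζ ∈ U, ∀ x, ‖g ζ x‖ ≤ G) (hkd : ∀ s, DifferentiableOn ℂ (fun ζ => k ζ s) U)
    (hgd : ∀ x, DifferentiableOn ℂ (fun ζ => g ζ x) U) (x : ℝ) :
    DifferentiableOn ℂ (fun ζ => volterraSum (k ζ) W (g ζ) x) U := by
  have hterm : ∀ n x, DifferentiableOn ℂ (fun ζ => volterraTerm (k ζ) W (g ζ) n x) U := by
    intro n
    induction n with
    | zero => exact hgd
    | succ n ih =>
      intro x
      exact differentiableOn_integral_of_dominated hU
        (bound := fun t => C * |W t| * (G * ((C * ∫ t, |W t|) ^ n / n.factorial)))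
        (fun ζ hζ => ((hk ζ hζ).integrable_integrand hW
          (volterraTerm_props (hk ζ hζ) hW (hgc ζ hζ) (hg ζ hζ) n).1
          (norm_volterraTerm_le (hk ζ hζ) hW (hgc ζ hζ) (hg ζ hζ) n) x).aestronglyMeasurable)
        (fun t => ((hkd (t - x)).mul_const _).mul (ih t))
        (fun ζ hζ => (hk ζ hζ).norm_integrand_le
          (norm_volterraTerm_le (hk ζ hζ) hW (hgc ζ hζ) (hg ζ hζ) n) x)
        ((hW.abs.const_mul C).mul_const _)
  exact Complex.differentiableOn_tsum_of_summable_norm (summable_volterra_bound _ G)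
    (fun n => hterm n x) hU fun n ζ hζ =>
      norm_volterraTerm_le (hk ζ hζ) hW (hgc ζ hζ) (hg ζ hζ) n x

/-! ### Variation of constants -/

theorem ae_hasDerivAt_primitive {h : ℝ → ℂ}
    (hh : ∀ b : ℝ, 0 ≤ b → IntervalIntegrable h volume 0 b) :
    ∀ᵐ x ∂halfLine, HasDerivAt (fun x => ∫ t in (0 : ℝ)..x, h t) (h x) x := by
  rw [ae_restrict_iff' measurableSet_Ioi]
  have key : ∀ n : ℕ, ∀ᵐ x : ℝ, x ∈ uIcc (0 : ℝ) n →
      HasDerivAt (fun x => ∫ t in (0 : ℝ)..x, h t) (h x) x := fun n => by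
    filter_upwards [(hh n n.cast_nonneg).ae_hasDerivAt_integral] with x hx hxm
    exact hx hxm 0 left_mem_uIcc
  filter_upwards [ae_all_iff.2 key] with x hx hx0
  obtain ⟨n, hn⟩ := exists_nat_ge x
  exact hx n (by rw [uIcc_of_le n.cast_nonneg]; exact ⟨le_of_lt hx0, hn⟩)

theorem hasDerivAt_cexp_mul (c : ℂ) (x : ℝ) :
    HasDerivAt (fun x : ℝ => Complex.exp (c * x)) (c * Complex.exp (c * x)) x := by
  have := ((Complex.ofRealCLM.hasDerivAt (x := x)).const_mul c).cexp
  simpa [mul_comm] using this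

theorem absCont_cexp_mul (c : ℂ) (a b : ℝ) :
    AbsolutelyContinuousOnInterval (fun x : ℝ => Complex.exp (c * x)) a b := by
  refine ContDiffOn.absolutelyContinuousOnInterval (ContDiff.contDiffOn ?_)
  exact (contDiff_const.mul Complex.ofRealCLM.contDiff).cexp

/-- The coefficient of `e^{iζx}` in the variation of constants formula; the coefficient of
`e^{-iζx}` is obtained by exchanging `ζ` with `-ζ`. -/
def variationCoeff (V : ℝ → ℝ) (ζ : ℂ) (u : ℝ → ℂ) (a : ℂ) (x : ℝ) : ℂ :=
  a + (2 * Complex.I * ζ)⁻¹ *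
    ∫ t in (0 : ℝ)..x, (V t : ℂ) * (Complex.exp (-(Complex.I * ζ) * t) * u t)

section

variable {V : ℝ → ℝ} {ζ : ℂ} {u : ℝ → ℂ}

theorem intervalIntegrable_variation (hV : IntegrableOn V (Ioi 0)) (c : ℂ)
    (hu : ContinuousOn u (Ici 0)) (b : ℝ) (hb : 0 ≤ b) :
    IntervalIntegrable (fun t : ℝ => (V t : ℂ) * (Complex.exp (c * t) * u t)) volume 0 b := by
  refine intervalIntegrable_potential_mul hV le_rfl hb ?_
  refine ContinuousOn.mul (by fun_prop) (hu.mono ?_)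
  rw [uIcc_of_le hb]
  exact fun x hx => hx.1

theorem absCont_variationCoeff (hV : IntegrableOn V (Ioi 0)) (hu : ContinuousOn u (Ici 0)) (a : ℂ)
    (b : ℝ) (hb : 0 ≤ b) : AbsolutelyContinuousOnInterval (variationCoeff V ζ u a) 0 b := by
  have h1 : AbsolutelyContinuousOnInterval (fun _ : ℝ => a) 0 b :=
    contDiffOn_const.absolutelyContinuousOnInterval
  have h2 := (absCont_primitive (intervalIntegrable_variation hV (-(Complex.I * ζ)) hu b
    hb)).const_smul (2 * Complex.I * ζ)⁻¹
  exact h1.add h2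

theorem ae_hasDerivAt_variationCoeff (hV : IntegrableOn V (Ioi 0)) (hu : ContinuousOn u (Ici 0))
    (a : ℂ) : ∀ᵐ x ∂halfLine, HasDerivAt (variationCoeff V ζ u a)
      ((2 * Complex.I * ζ)⁻¹ * ((V x : ℂ) * (Complex.exp (-(Complex.I * ζ) * x) * u x))) x := by
  filter_upwards [ae_hasDerivAt_primitive (intervalIntegrable_variation hV (-(Complex.I * ζ)) hu)]
    with x hx
  exact (hx.const_mul _).const_add _

/-- A continuous solution of the integral equation of the variation of constants solves the
differential equation. -/
theorem isSolution_of_variation (hV : IntegrableOn V (Ioi 0)) (hζ : ζ ≠ 0)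
    (hu : ContinuousOn u (Ici 0)) (a b : ℂ)
    (h : ∀ x : ℝ, 0 ≤ x → u x = variationCoeff V ζ u a x * Complex.exp (Complex.I * ζ * x)
      + variationCoeff V (-ζ) u b x * Complex.exp (-(Complex.I * ζ) * x)) :
    IsSolution V (ζ ^ 2) u ∧ ∀ x : ℝ, 0 ≤ x → hderiv u x
      = Complex.I * ζ * (variationCoeff V ζ u a x * Complex.exp (Complex.I * ζ * x)
        - variationCoeff V (-ζ) u b x * Complex.exp (-(Complex.I * ζ) * x)) := by
  have hα := absCont_variationCoeff (ζ := ζ) hV hu a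
  have hβ := absCont_variationCoeff (ζ := -ζ) hV hu b
  have hee : ∀ x : ℝ, Complex.exp (-(Complex.I * ζ) * x) * Complex.exp (Complex.I * ζ * x) = 1 :=
    fun x => by rw [← Complex.exp_add]; simp
  refine isSolution_of_system (fun r hr => ?_) (fun r hr => ?_) ?_ ?_
  · refine absCont_congr ((absCont_mul (hα r hr) (absCont_cexp_mul (Complex.I * ζ) 0 r)).add
      (absCont_mul (hβ r hr) (absCont_cexp_mul (-(Complex.I * ζ)) 0 r))) fun x hx => ?_
    rw [uIcc_of_le hr] at hx
    exact (h x hx.1).symm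
  · exact ((absCont_mul (hα r hr) (absCont_cexp_mul (Complex.I * ζ) 0 r)).sub
      (absCont_mul (hβ r hr) (absCont_cexp_mul (-(Complex.I * ζ)) 0 r))).const_smul (Complex.I * ζ)
  · filter_upwards [ae_hasDerivAt_variationCoeff (ζ := ζ) hV hu a,
      ae_hasDerivAt_variationCoeff (ζ := -ζ) hV hu b, ae_restrict_mem measurableSet_Ioi]
      with x h1 h2 hx0
    have h3 := (h1.mul (hasDerivAt_cexp_mul (Complex.I * ζ) x)).add
      (h2.mul (hasDerivAt_cexp_mul (-(Complex.I * ζ)) x))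
    have h4 : HasDerivAt u _ x := h3.congr_of_eventuallyEq (by
      filter_upwards [Ioi_mem_nhds hx0] with y hy using h y (le_of_lt hy))
    convert! h4 using 1
    simp only [mul_neg, neg_mul, neg_neg, inv_neg]
    ring
  · filter_upwards [ae_hasDerivAt_variationCoeff (ζ := ζ) hV hu a,
      ae_hasDerivAt_variationCoeff (ζ := -ζ) hV hu b, ae_restrict_mem measurableSet_Ioi]
      with x h1 h2 hx0
    have h3 := ((h1.mul (hasDerivAt_cexp_mul (Complex.I * ζ) x)).sub
      (h2.mul (hasDerivAt_cexp_mul (-(Complex.I * ζ)) x))).const_mul (Complex.I * ζ)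
    convert! h3 using 1
    have e := hee x
    have hux := h x (le_of_lt hx0)
    have hc : Complex.I * ζ * (2 * Complex.I * ζ)⁻¹ = 1 / 2 := by
      field_simp [Complex.I_ne_zero]
    have hI : Complex.I ^ 2 = -1 := Complex.I_sq
    simp only [mul_neg, neg_mul, neg_neg, inv_neg] at e hux ⊢
    linear_combination (ζ ^ 2 * (-1)) * hux
      - ((V x : ℂ) * u x * 2 * (Complex.I * ζ * (2 * Complex.I * ζ)⁻¹)) * e
      - 2 * (V x : ℂ) * u x * hc
      - (ζ ^ 2 * (variationCoeff V ζ u a x * Complex.exp (Complex.I * ζ * x)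
        + variationCoeff V (-ζ) u b x * Complex.exp (-(Complex.I * ζ * x)))) * hI

end

/-! ### Construction of the Jost solution and of the regular solution -/

/-- The Volterra kernel `(e^{2iζs} - 1) / (2iζ)`, `s > 0`, extended by `0`. -/
def jostKernel (ζ : ℂ) (s : ℝ) : ℂ :=
  (2 * Complex.I * ζ)⁻¹ * (Complex.exp (2 * Complex.I * ζ * (max s 0 : ℝ)) - 1)

theorem norm_cexp_two_I_mul_le_one {ζ : ℂ} (hζ : 0 ≤ ζ.im) {s : ℝ} (hs : 0 ≤ s) :
    ‖Complex.exp (2 * Complex.I * ζ * s)‖ ≤ 1 := by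
  rw [Complex.norm_exp, Real.exp_le_one_iff]
  have : (2 * Complex.I * ζ * s).re = -(2 * ζ.im * s) := by simp
  rw [this]
  have := mul_nonneg hζ hs
  linarith

theorem isVolterraKernel_jostKernel {ζ : ℂ} (hζ : 0 ≤ ζ.im) {r : ℝ} (hr : 0 < r) (hrζ : r ≤ ‖ζ‖) :
    IsVolterraKernel (jostKernel ζ) r⁻¹ where
  continuous := by unfold jostKernel; fun_prop
  support s hs := by simp [jostKernel, max_eq_right hs]
  bound s := by
    have h1 : ‖Complex.exp (2 * Complex.I * ζ * (max s 0 : ℝ)) - 1‖ ≤ 2 := by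
      refine (norm_sub_le _ _).trans ?_
      rw [norm_one]
      linarith [norm_cexp_two_I_mul_le_one hζ (le_max_right s 0)]
    unfold jostKernel
    rw [norm_mul, norm_inv, norm_mul, norm_mul, Complex.norm_I, Complex.norm_ofNat]
    calc (2 * 1 * ‖ζ‖)⁻¹ * ‖Complex.exp (2 * Complex.I * ζ * (max s 0 : ℝ)) - 1‖
        ≤ (2 * 1 * r)⁻¹ * 2 := by gcongr
      _ = r⁻¹ := by field_simp

/-- The potential extended by `0` to the whole line. -/
def extend (V : ℝ → ℝ) : ℝ → ℝ := (Ioi 0).indicator V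

theorem integrable_extend {V : ℝ → ℝ} (hV : IntegrableOn V (Ioi 0)) : Integrable (extend V) :=
  hV.integrable_indicator measurableSet_Ioi

/-- The function `m(x) = e^{-iζx} θ(x)`, for the Jost solution `θ`. -/
def jostFactor (V : ℝ → ℝ) (ζ : ℂ) : ℝ → ℂ :=
  volterraSum (jostKernel ζ) (extend V) fun _ => 1

/-- The Jost solution, constructed from the Volterra equation for `jostFactor`. -/
def jost (V : ℝ → ℝ) (ζ : ℂ) (x : ℝ) : ℂ := Complex.exp (Complex.I * ζ * x) * jostFactor V ζ x

theorem tendsto_tail {W : ℝ → ℝ} (hW : Integrable W) : Tendsto (tail W) atTop (𝓝 0) := by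
  have h := intervalIntegral_tendsto_integral_Ioi 0 hW.abs.integrableOn tendsto_id
  have h2 := h.const_sub (tail W 0)
  rw [show tail W 0 - ∫ t in Ioi (0 : ℝ), |W t| = 0 by simp [tail]] at h2
  exact h2.congr fun x => (tail_eq_sub hW x).symm

section

variable {V : ℝ → ℝ} {ζ : ℂ}

theorem continuous_jostFactor (hV : IntegrableOn V (Ioi 0)) (hζ : 0 ≤ ζ.im) (hζ0 : ζ ≠ 0) :
    Continuous (jostFactor V ζ) :=
  continuous_volterraSum (isVolterraKernel_jostKernel hζ (norm_pos_iff.2 hζ0) le_rfl)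
    (integrable_extend hV) continuous_const (G := 1) (by simp)

/-- A bound for `e^{-iζx} θ(x, ζ)` that is uniform for `ζ` away from `0`. -/
theorem norm_jostFactor_le (hV : IntegrableOn V (Ioi 0)) (hζ : 0 ≤ ζ.im) {r : ℝ} (hr : 0 < r)
    (hrζ : r ≤ ‖ζ‖) (x : ℝ) : ‖jostFactor V ζ x‖ ≤ Real.exp (r⁻¹ * ∫ t, |extend V t|) := by
  have := norm_volterraSum_le (isVolterraKernel_jostKernel hζ hr hrζ)
    (integrable_extend hV) (continuous_const (y := (1 : ℂ))) (G := 1) (by simp) x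
  simpa [jostFactor] using this

theorem jostFactor_eq (hV : IntegrableOn V (Ioi 0)) (hζ : 0 ≤ ζ.im) (hζ0 : ζ ≠ 0) (x : ℝ) :
    jostFactor V ζ x = 1 + ∫ t, jostKernel ζ (t - x) * (extend V t : ℂ) * jostFactor V ζ t :=
  volterraSum_eq (isVolterraKernel_jostKernel hζ (norm_pos_iff.2 hζ0) le_rfl)
    (integrable_extend hV) continuous_const (G := 1) (by simp) x

theorem continuous_jost (hV : IntegrableOn V (Ioi 0)) (hζ : 0 ≤ ζ.im) (hζ0 : ζ ≠ 0) :
    Continuous (jost V ζ) := by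
  have := continuous_jostFactor hV hζ hζ0
  unfold jost
  fun_prop

theorem integrable_extend_mul_jostFactor (hV : IntegrableOn V (Ioi 0)) (hζ : 0 ≤ ζ.im)
    (hζ0 : ζ ≠ 0) : Integrable fun t => (extend V t : ℂ) * jostFactor V ζ t :=
  (integrable_extend hV).ofReal.mul_bdd
    (continuous_jostFactor hV hζ hζ0).aestronglyMeasurable
    (Eventually.of_forall (norm_jostFactor_le hV hζ (norm_pos_iff.2 hζ0) le_rfl))

/-- The integral `∫₀^∞ V(t) e^{-iζt} θ(t) dt`. -/
def jostMoment (V : ℝ → ℝ) (ζ : ℂ) : ℂ := ∫ t, (extend V t : ℂ) * jostFactor V ζ t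

theorem cexp_neg_mul_jost (x : ℝ) :
    Complex.exp (-(Complex.I * ζ) * x) * jost V ζ x = jostFactor V ζ x := by
  unfold jost
  rw [← mul_assoc, ← Complex.exp_add]
  simp

theorem integral_extend (f : ℝ → ℂ) :
    ∫ t, (extend V t : ℂ) * f t = ∫ t in Ioi (0 : ℝ), (V t : ℂ) * f t := by
  rw [← integral_indicator measurableSet_Ioi]
  refine integral_congr_ae (Eventually.of_forall fun t => ?_)
  by_cases ht : t ∈ Ioi (0 : ℝ)
  · simp [extend, indicator_of_mem ht]
  · simp [extend, indicator_of_notMem ht]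

theorem integrableOn_mul_jostFactor (hV : IntegrableOn V (Ioi 0)) (hζ : 0 ≤ ζ.im)
    (hζ0 : ζ ≠ 0) : IntegrableOn (fun t => (V t : ℂ) * jostFactor V ζ t) (Ioi 0) :=
  hV.ofReal.mul_bdd (continuous_jostFactor hV hζ hζ0).aestronglyMeasurable
    (Eventually.of_forall (norm_jostFactor_le hV hζ (norm_pos_iff.2 hζ0) le_rfl))

theorem integrableOn_mul_cexp_jost (hV : IntegrableOn V (Ioi 0)) (hζ : 0 ≤ ζ.im)
    (hζ0 : ζ ≠ 0) : IntegrableOn (fun t : ℝ => (V t : ℂ) *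
      (Complex.exp (Complex.I * ζ * t) * jost V ζ t)) (Ioi 0) := by
  have h := (integrableOn_mul_jostFactor hV hζ hζ0).bdd_mul
    (f := fun t : ℝ => Complex.exp (2 * Complex.I * ζ * t)) (c := 1)
    (by fun_prop) ?_
  · refine h.congr (Eventually.of_forall fun t => ?_)
    simp only [jost]
    rw [show 2 * Complex.I * ζ * (t : ℂ) = Complex.I * ζ * t + Complex.I * ζ * t by ring,
      Complex.exp_add]
    ring
  · rw [ae_restrict_iff' measurableSet_Ioi]
    exact Eventually.of_forall fun t ht => norm_cexp_two_I_mul_le_one hζ (le_of_lt ht)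

/-- The Jost solution satisfies the integral equation of the variation of constants. -/
theorem jost_variation (hV : IntegrableOn V (Ioi 0)) (hζ : 0 ≤ ζ.im) (hζ0 : ζ ≠ 0) (x : ℝ)
    (hx : 0 ≤ x) : jost V ζ x =
      variationCoeff V ζ (jost V ζ) (1 - (2 * Complex.I * ζ)⁻¹ * jostMoment V ζ) x
        * Complex.exp (Complex.I * ζ * x)
      + variationCoeff V (-ζ) (jost V ζ) ((2 * Complex.I * ζ)⁻¹ * ∫ t in Ioi (0 : ℝ), (V t : ℂ) *
          (Complex.exp (Complex.I * ζ * t) * jost V ζ t)) x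
        * Complex.exp (-(Complex.I * ζ) * x) := by
  have i1 := integrableOn_mul_jostFactor hV hζ hζ0
  have i2 := integrableOn_mul_cexp_jost hV hζ hζ0
  have hsub : Ioi x ⊆ Ioi (0 : ℝ) := Ioi_subset_Ioi hx
  have e1 := intervalIntegral.integral_Ioi_sub_Ioi' i1 (i1.mono_set hsub)
  have e2 := intervalIntegral.integral_Ioi_sub_Ioi' i2 (i2.mono_set hsub)
  have hk : (∫ t, jostKernel ζ (t - x) * (extend V t : ℂ) * jostFactor V ζ t)
      * Complex.exp (Complex.I * ζ * x)
      = (2 * Complex.I * ζ)⁻¹ * (Complex.exp (-(Complex.I * ζ) * x) *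
          (∫ t in Ioi x, (V t : ℂ) * (Complex.exp (Complex.I * ζ * t) * jost V ζ t))
        - Complex.exp (Complex.I * ζ * x) * ∫ t in Ioi x, (V t : ℂ) * jostFactor V ζ t) := by
    rw [← integral_const_mul, ← integral_const_mul,
      ← integral_sub ((i2.mono_set hsub).const_mul _) ((i1.mono_set hsub).const_mul _),
      ← integral_const_mul, ← integral_mul_const, ← integral_indicator measurableSet_Ioi]
    refine integral_congr_ae (Eventually.of_forall fun t => ?_)
    by_cases ht : t ∈ Ioi x
    · have ht' : x < t := ht
      simp only [indicator_of_mem ht, jostKernel, jost]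
      rw [max_eq_left (by linarith), extend, indicator_of_mem (hsub ht)]
      have hexp : Complex.exp (2 * Complex.I * ζ * ((t - x : ℝ) : ℂ))
            * Complex.exp (Complex.I * ζ * x)
          = Complex.exp (-(Complex.I * ζ) * x) * Complex.exp (Complex.I * ζ * t)
            * Complex.exp (Complex.I * ζ * t) := by
        rw [← Complex.exp_add, ← Complex.exp_add, ← Complex.exp_add]
        congr 1
        push_cast
        ring
      linear_combination (2 * Complex.I * ζ)⁻¹ * (V t : ℂ) * jostFactor V ζ t * hexp
    · simp only [indicator_of_notMem ht]
      have : t - x ≤ 0 := by simpa using ht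
      simp [jostKernel, max_eq_right this]
  have hm : jostMoment V ζ = ∫ t in Ioi (0 : ℝ), (V t : ℂ) * jostFactor V ζ t := integral_extend _
  have hj : jost V ζ x = Complex.exp (Complex.I * ζ * x) * jostFactor V ζ x := rfl
  rw [jostFactor_eq hV hζ hζ0] at hj
  unfold variationCoeff
  simp only [cexp_neg_mul_jost]
  simp only [mul_neg, neg_neg, inv_neg, neg_mul] at e1 e2 hk ⊢
  rw [hj, ← e1, ← e2, hm]
  linear_combination hk

theorem jost_isSolution (hV : IntegrableOn V (Ioi 0)) (hζ : 0 ≤ ζ.im) (hζ0 : ζ ≠ 0) :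
    IsSolution V (ζ ^ 2) (jost V ζ) ∧ ∀ x : ℝ, 0 ≤ x → hderiv (jost V ζ) x
      = Complex.I * ζ * (2 * variationCoeff V ζ (jost V ζ)
          (1 - (2 * Complex.I * ζ)⁻¹ * jostMoment V ζ) x * Complex.exp (Complex.I * ζ * x)
        - jost V ζ x) := by
  obtain ⟨h1, h2⟩ := isSolution_of_variation hV hζ0 (continuous_jost hV hζ hζ0).continuousOn _ _
    (jost_variation hV hζ hζ0)
  refine ⟨h1, fun x hx => ?_⟩
  rw [h2 x hx]
  linear_combination (Complex.I * ζ) * jost_variation hV hζ hζ0 x hx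

/-- The boundary slope of the Jost solution, in a form that is visibly holomorphic in `ζ`. -/
theorem hderiv_jost_zero (hV : IntegrableOn V (Ioi 0)) (hζ : 0 ≤ ζ.im) (hζ0 : ζ ≠ 0) :
    hderiv (jost V ζ) 0 = Complex.I * ζ * (2 - jost V ζ 0) - jostMoment V ζ := by
  rw [(jost_isSolution hV hζ hζ0).2 0 le_rfl]
  simp only [variationCoeff, intervalIntegral.integral_same, Complex.ofReal_zero, mul_zero,
    Complex.exp_zero, add_zero]
  field_simp [Complex.I_ne_zero]
  ring

theorem tendsto_jostFactor (hV : IntegrableOn V (Ioi 0)) (hζ : 0 ≤ ζ.im) (hζ0 : ζ ≠ 0) :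
    Tendsto (jostFactor V ζ) atTop (𝓝 1) := by
  have hk := isVolterraKernel_jostKernel hζ (norm_pos_iff.2 hζ0) le_rfl
  have hW := integrable_extend hV
  rw [tendsto_iff_norm_sub_tendsto_zero]
  set B := Real.exp (‖ζ‖⁻¹ * ∫ t, |extend V t|) with hB
  have hlim := (tendsto_tail hW).const_mul (‖ζ‖⁻¹ * B)
  rw [mul_zero] at hlim
  refine squeeze_zero (fun _ => norm_nonneg _) (fun x => ?_) hlim
  rw [jostFactor_eq hV hζ hζ0, add_sub_cancel_left, tail, ← integral_const_mul,
    ← integral_indicator measurableSet_Ioi]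
  refine norm_integral_le_of_norm_le
    ((hW.abs.const_mul (‖ζ‖⁻¹ * B)).indicator measurableSet_Ioi)
    (Eventually.of_forall fun t => ?_)
  by_cases ht : t ∈ Ioi x
  · rw [indicator_of_mem ht]
    refine (hk.norm_integrand_le
      (norm_jostFactor_le hV hζ (norm_pos_iff.2 hζ0) le_rfl) x t).trans (le_of_eq ?_)
    ring
  · rw [indicator_of_notMem ht, hk.support _ (by simpa using ht)]
    simp

theorem isJostSolution_jost (hV : IntegrableOn V (Ioi 0)) (hζ : 0 ≤ ζ.im) (hζ0 : ζ ≠ 0) :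
    IsJostSolution V ζ (jost V ζ) where
  solution := (jost_isSolution hV hζ hζ0).1
  asymptotics := by
    refine (tendsto_jostFactor hV hζ hζ0).congr fun x => ?_
    rw [jost, mul_div_cancel_left₀ _ (Complex.exp_ne_zero _)]
  asymptotics_deriv := by
    have h1 := intervalIntegral_tendsto_integral_Ioi 0 (integrableOn_mul_jostFactor hV hζ hζ0)
      tendsto_id
    rw [← integral_extend, ← jostMoment] at h1
    have h2 : Tendsto (fun x => 2 * variationCoeff V ζ (jost V ζ)
        (1 - (2 * Complex.I * ζ)⁻¹ * jostMoment V ζ) x - jostFactor V ζ x) atTop (𝓝 1) := by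
      have := (((h1.const_mul (2 * Complex.I * ζ)⁻¹).const_add
        (1 - (2 * Complex.I * ζ)⁻¹ * jostMoment V ζ)).const_mul 2).sub
        (tendsto_jostFactor hV hζ hζ0)
      simp only [variationCoeff, cexp_neg_mul_jost]
      convert! this using 2
      ring
    refine h2.congr' ?_
    filter_upwards [eventually_ge_atTop 0] with x hx
    rw [(jost_isSolution hV hζ hζ0).2 x hx, eq_div_iff (mul_ne_zero (mul_ne_zero Complex.I_ne_zero
      hζ0) (Complex.exp_ne_zero _))]
    simp only [jost]
    ring

/-- Existence of the regular solution, together with the growth bound `O(e^{x Im ζ})`. -/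
theorem exists_regularSolution (hV : IntegrableOn V (Ioi 0)) (γ : ℝ) (hζ : 0 ≤ ζ.im)
    (hζ0 : ζ ≠ 0) : ∃ φ, IsRegularSolution V γ ζ φ ∧ ∃ B : ℝ, ∀ x : ℝ, 0 ≤ x →
      ‖Complex.exp (Complex.I * ζ * x) * φ x‖ ≤ B ∧
      ‖Complex.exp (Complex.I * ζ * x) * hderiv φ x‖ ≤ B := by
  set a : ℂ := (1 + γ / (Complex.I * ζ)) / 2 with ha
  set b : ℂ := (1 - γ / (Complex.I * ζ)) / 2 with hb
  set g : ℝ → ℂ := fun s => a * Complex.exp (2 * Complex.I * ζ * (max (-s) 0 : ℝ)) + b with hg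
  set W : ℝ → ℝ := fun t => extend V (-t) with hW
  have hWi : Integrable W := (integrable_extend hV).comp_neg
  have hk := isVolterraKernel_jostKernel hζ (norm_pos_iff.2 hζ0) le_rfl
  have hgc : Continuous g := by simp only [hg]; fun_prop
  have hgb : ∀ s, ‖g s‖ ≤ ‖a‖ + ‖b‖ := fun s => by
    refine (norm_add_le _ _).trans ?_
    rw [norm_mul]
    have := mul_le_of_le_one_right (norm_nonneg a)
      (norm_cexp_two_I_mul_le_one hζ (le_max_right (-s) 0))
    linarith
  -- Reflecting the half-line turns the Volterra equation with initial point `0` into one over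
  -- `(x, ∞)`, for the function `n (-x) = e^{iζx} φ(x)`.
  set n := volterraSum (jostKernel ζ) W g with hn
  set M := (‖a‖ + ‖b‖) * Real.exp (‖ζ‖⁻¹ * ∫ t, |W t|) with hM
  have hnc : Continuous n := continuous_volterraSum hk hWi hgc hgb
  have hnb : ∀ x, ‖n x‖ ≤ M := norm_volterraSum_le hk hWi hgc hgb
  have hneq : ∀ x, 0 ≤ x → n (-x) = a * Complex.exp (2 * Complex.I * ζ * x) + b
      + ∫ t in (0 : ℝ)..x, (2 * Complex.I * ζ)⁻¹ * (Complex.exp (2 * Complex.I * ζ * (x - t)) - 1)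
        * V t * n (-t) := fun x hx => by
    have h1 := volterraSum_eq hk hWi hgc hgb (-x)
    rw [← hn] at h1
    rw [h1]
    congr 1
    · simp [hg, max_eq_left hx]
    · rw [← integral_neg_eq_self, intervalIntegral.integral_of_le hx,
        integral_Ioc_eq_integral_Ioo, ← integral_indicator measurableSet_Ioo]
      refine integral_congr_ae (Eventually.of_forall fun t => ?_)
      simp only [hW, neg_neg, sub_neg_eq_add]
      by_cases h0 : 0 < t
      · by_cases htx : t < x
        · rw [indicator_of_mem (show t ∈ Ioo 0 x from ⟨h0, htx⟩), extend,
            indicator_of_mem (show t ∈ Ioi (0 : ℝ) from h0), jostKernel,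
            max_eq_left (by linarith)]
          congr 6
          push_cast
          ring
        · rw [indicator_of_notMem (fun h => htx h.2), hk.support _ (by linarith)]
          simp
      · rw [indicator_of_notMem (fun h => h0 h.1), extend,
          indicator_of_notMem (show t ∉ Ioi (0 : ℝ) from h0)]
        simp
  set φ : ℝ → ℂ := fun x => Complex.exp (-(Complex.I * ζ) * x) * n (-x) with hφ
  have hφc : Continuous φ := by simp only [hφ]; fun_prop
  have hnφ : ∀ x : ℝ, Complex.exp (Complex.I * ζ * x) * φ x = n (-x) := fun x => by
    simp only [hφ]
    rw [← mul_assoc, ← Complex.exp_add]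
    simp
  have hvar : ∀ x : ℝ, 0 ≤ x → φ x = variationCoeff V ζ φ a x * Complex.exp (Complex.I * ζ * x)
      + variationCoeff V (-ζ) φ b x * Complex.exp (-(Complex.I * ζ) * x) := fun x hx => by
    have j1 := intervalIntegrable_variation hV (-(Complex.I * ζ)) hφc.continuousOn x hx
    have j2 := intervalIntegrable_variation hV (Complex.I * ζ) hφc.continuousOn x hx
    have hint : Complex.exp (-(Complex.I * ζ) * x) * ∫ t in (0 : ℝ)..x, (2 * Complex.I * ζ)⁻¹
          * (Complex.exp (2 * Complex.I * ζ * (x - t)) - 1) * V t * n (-t)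
        = (2 * Complex.I * ζ)⁻¹ * (Complex.exp (Complex.I * ζ * x) *
          (∫ t in (0 : ℝ)..x, (V t : ℂ) * (Complex.exp (-(Complex.I * ζ) * t) * φ t))
          - Complex.exp (-(Complex.I * ζ) * x) *
          ∫ t in (0 : ℝ)..x, (V t : ℂ) * (Complex.exp (Complex.I * ζ * t) * φ t)) := by
      rw [← intervalIntegral.integral_const_mul, ← intervalIntegral.integral_const_mul,
        ← intervalIntegral.integral_const_mul,
        ← intervalIntegral.integral_sub (j1.const_mul _) (j2.const_mul _),
        ← intervalIntegral.integral_const_mul]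
      refine intervalIntegral.integral_congr fun t _ => ?_
      simp only [hnφ]
      simp only [hφ]
      have hexp : Complex.exp (-(Complex.I * ζ) * x) * Complex.exp (2 * Complex.I * ζ * (x - t))
          = Complex.exp (Complex.I * ζ * x) * (Complex.exp (-(Complex.I * ζ) * t)
            * Complex.exp (-(Complex.I * ζ) * t)) := by
        rw [← Complex.exp_add, ← Complex.exp_add, ← Complex.exp_add]
        congr 1
        ring
      linear_combination (2 * Complex.I * ζ)⁻¹ * (V t : ℂ) * n (-t) * hexp
    have hexp : Complex.exp (-(Complex.I * ζ) * x) * Complex.exp (2 * Complex.I * ζ * x)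
        = Complex.exp (Complex.I * ζ * x) := by
      rw [← Complex.exp_add]
      congr 1
      ring
    have hφx : φ x = Complex.exp (-(Complex.I * ζ) * x) * n (-x) := rfl
    rw [hneq x hx] at hφx
    unfold variationCoeff
    simp only [mul_neg, neg_neg, inv_neg, neg_mul] at hφx hint hexp ⊢
    linear_combination hφx + hint + a * hexp
  obtain ⟨hsol, hder⟩ := isSolution_of_variation hV hζ0 hφc.continuousOn a b hvar
  have hφ0 : φ 0 = 1 := by
    rw [hvar 0 le_rfl]
    simp only [variationCoeff, intervalIntegral.integral_same, Complex.ofReal_zero, mul_zero,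
      Complex.exp_zero, add_zero, ha, hb]
    ring
  have hφ0' : hderiv φ 0 = γ := by
    rw [hder 0 le_rfl]
    simp only [variationCoeff, intervalIntegral.integral_same, Complex.ofReal_zero, mul_zero,
      Complex.exp_zero, add_zero, ha, hb]
    field_simp [Complex.I_ne_zero]
    ring
  -- `e^{iζx} φ'(x) = iζ (e^{iζx} φ(x) - 2β(x))` with the bounded coefficient `β` of `e^{-iζx}`.
  have hβ : ∀ x : ℝ, 0 ≤ x → ‖variationCoeff V (-ζ) φ b x‖
      ≤ ‖b‖ + ‖(2 * Complex.I * ζ)⁻¹‖ * (M * ∫ t, |extend V t|) := fun x hx => by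
    refine (norm_add_le _ _).trans (add_le_add_right ?_ _)
    simp only [mul_neg, neg_neg, inv_neg, norm_mul, norm_neg]
    refine mul_le_mul_of_nonneg_left ?_ (norm_nonneg _)
    rw [intervalIntegral.integral_of_le hx, ← integral_indicator measurableSet_Ioc,
      ← integral_const_mul]
    refine norm_integral_le_of_norm_le ((integrable_extend hV).abs.const_mul M)
      (Eventually.of_forall fun t => ?_)
    have hM0 : 0 ≤ M := (norm_nonneg _).trans (hnb 0)
    by_cases ht : t ∈ Ioc 0 x
    · rw [indicator_of_mem ht, hnφ, norm_mul, Complex.norm_real, Real.norm_eq_abs, extend,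
        indicator_of_mem (show t ∈ Ioi (0 : ℝ) from ht.1), mul_comm]
      exact mul_le_mul_of_nonneg_right (hnb _) (abs_nonneg _)
    · rw [indicator_of_notMem ht, norm_zero]
      positivity
  refine ⟨φ, ⟨hsol, hφ0, hφ0'⟩, max M (‖Complex.I * ζ‖ * (M + 2 * (‖b‖ +
    ‖(2 * Complex.I * ζ)⁻¹‖ * (M * ∫ t, |extend V t|)))), fun x hx => ⟨?_, ?_⟩⟩
  · rw [hnφ]
    exact (hnb _).trans (le_max_left _ _)
  · refine le_trans ?_ (le_max_right _ _)
    have hee : Complex.exp (Complex.I * ζ * x) * Complex.exp (-(Complex.I * ζ) * x) = 1 := by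
      rw [← Complex.exp_add]; simp
    have : Complex.exp (Complex.I * ζ * x) * hderiv φ x
        = Complex.I * ζ * (n (-x) - 2 * variationCoeff V (-ζ) φ b x) := by
      rw [hder x hx, ← hnφ]
      linear_combination -(Complex.I * ζ * Complex.exp (Complex.I * ζ * x)) * hvar x hx
        - 2 * Complex.I * ζ * variationCoeff V (-ζ) φ b x * hee
    rw [this, norm_mul]
    refine mul_le_mul_of_nonneg_left ((norm_sub_le _ _).trans ?_) (norm_nonneg _)
    rw [norm_mul, Complex.norm_ofNat]
    linarith [hnb (-x), hβ x hx]

end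

/-! ### The Jost function -/

section

variable {V : ℝ → ℝ} {ζ : ℂ}

/-- The Neumann series for `jostFactor` is dominated uniformly only away from `ζ = 0`, which is why
`‖ζ‖` is bounded from below. -/
theorem differentiableOn_jostFactor (hV : IntegrableOn V (Ioi 0)) {r : ℝ} (hr : 0 < r) (x : ℝ) :
    DifferentiableOn ℂ (fun ζ => jostFactor V ζ x) {ζ | 0 < ζ.im ∧ r < ‖ζ‖} := by
  have hU : IsOpen {ζ : ℂ | 0 < ζ.im ∧ r < ‖ζ‖} :=
    (isOpen_lt continuous_const Complex.continuous_im).inter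
      (isOpen_lt continuous_const continuous_norm)
  refine differentiableOn_volterraSum hU (C := r⁻¹) (G := 1) (integrable_extend hV)
    (fun ζ hζ => isVolterraKernel_jostKernel hζ.1.le hr hζ.2.le) (fun _ _ => continuous_const)
    (by simp) (fun s => ?_) (fun _ => differentiableOn_const _) x
  intro ζ hζ
  have hζ0 : ζ ≠ 0 := norm_pos_iff.1 (hr.trans hζ.2)
  unfold jostKernel
  refine DifferentiableAt.differentiableWithinAt ?_
  have : 2 * Complex.I * ζ ≠ 0 := mul_ne_zero (by simp) hζ0
  fun_prop (disch := assumption)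

theorem differentiableAt_jost (hV : IntegrableOn V (Ioi 0)) (hζ : 0 < ζ.im) (x : ℝ) :
    DifferentiableAt ℂ (fun ζ => jost V ζ x) ζ ∧ DifferentiableAt ℂ (jostMoment V) ζ := by
  have hζ0 : ζ ≠ 0 := fun h => by simp [h] at hζ
  have hr : 0 < ‖ζ‖ / 2 := by have := norm_pos_iff.2 hζ0; positivity
  have hU : IsOpen {ζ' : ℂ | 0 < ζ'.im ∧ ‖ζ‖ / 2 < ‖ζ'‖} :=
    (isOpen_lt continuous_const Complex.continuous_im).inter
      (isOpen_lt continuous_const continuous_norm)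
  have hn := hU.mem_nhds (x := ζ) ⟨hζ, by linarith⟩
  constructor
  · have := (differentiableOn_jostFactor hV hr x).differentiableAt hn
    unfold jost
    fun_prop
  · refine DifferentiableOn.differentiableAt (differentiableOn_integral_of_dominated hU
      (bound := fun t => |extend V t| * Real.exp ((‖ζ‖ / 2)⁻¹ * ∫ t, |extend V t|))
      (fun ζ' hζ' => ?_) (fun t => ?_) (fun ζ' hζ' t => ?_) ?_) hn
    · exact (integrable_extend_mul_jostFactor hV hζ'.1.le
        (norm_pos_iff.1 (hr.trans hζ'.2))).aestronglyMeasurable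
    · exact (differentiableOn_jostFactor hV hr t).const_mul _
    · rw [norm_mul, Complex.norm_real, Real.norm_eq_abs]
      exact mul_le_mul_of_nonneg_left (norm_jostFactor_le hV hζ'.1.le hr hζ'.2.le t) (abs_nonneg _)
    · exact (integrable_extend hV).abs.mul_const _

theorem norm_cexp_I_mul (ζ : ℂ) (x : ℝ) :
    ‖Complex.exp (Complex.I * ζ * x)‖ = Real.exp (-(ζ.im * x)) := by
  rw [Complex.norm_exp]
  simp

theorem exists_bound_of_tendsto {f : ℝ → ℂ} {l : ℂ} (hf : ContinuousOn f (Ici 0))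
    (hl : Tendsto f atTop (𝓝 l)) : ∃ B, ∀ x : ℝ, 0 ≤ x → ‖f x‖ ≤ B := by
  obtain ⟨X, hX⟩ := eventually_atTop.1 (hl.norm.eventually_le_const (lt_add_one ‖l‖))
  obtain ⟨B, hB⟩ := isCompact_Icc.exists_bound_of_continuousOn
    (hf.mono (fun x hx => hx.1 : Icc 0 X ⊆ Ici 0))
  refine ⟨max B (‖l‖ + 1), fun x hx => ?_⟩
  rcases le_total x X with h | h
  · exact (hB x ⟨hx, h⟩).trans (le_max_left _ _)
  · exact (hX x h).trans (le_max_right _ _)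

theorem IsJostSolution.exists_decay {θ : ℝ → ℂ} (hθ : IsJostSolution V ζ θ) (hζ0 : ζ ≠ 0) :
    ∃ B : ℝ, ∀ x : ℝ, 0 ≤ x →
      ‖θ x‖ ≤ B * Real.exp (-(ζ.im * x)) ∧ ‖hderiv θ x‖ ≤ B * Real.exp (-(ζ.im * x)) := by
  obtain ⟨B₁, h₁⟩ := exists_bound_of_tendsto
    (hθ.solution.continuousOn.div (by fun_prop) fun x _ => Complex.exp_ne_zero _) hθ.asymptotics
  obtain ⟨B₂, h₂⟩ := exists_bound_of_tendsto
    (hθ.solution.continuousOn_hderiv.div (by fun_prop) fun x _ =>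
      mul_ne_zero (mul_ne_zero Complex.I_ne_zero hζ0) (Complex.exp_ne_zero _)) hθ.asymptotics_deriv
  refine ⟨max B₁ (B₂ * ‖ζ‖), fun x hx => ⟨?_, ?_⟩⟩
  · have := h₁ x hx
    rw [Pi.div_apply, norm_div, norm_cexp_I_mul, div_le_iff₀ (Real.exp_pos _)] at this
    exact this.trans (mul_le_mul_of_nonneg_right (le_max_left _ _) (Real.exp_pos _).le)
  · have := h₂ x hx
    rw [Pi.div_apply, norm_div, norm_mul, norm_mul, Complex.norm_I, one_mul, norm_cexp_I_mul,
      div_le_iff₀ (mul_pos (norm_pos_iff.2 hζ0) (Real.exp_pos _)), ← mul_assoc] at this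
    exact this.trans (mul_le_mul_of_nonneg_right (le_max_right _ _) (Real.exp_pos _).le)

/-- Jost solutions have a well defined boundary value `γ θ(0) - θ'(0)`: the Wronskian of the
regular solution, of size `O(e^{x Im ζ})`, and the difference of two Jost solutions, of size
`o(e^{-x Im ζ})`, is constant and tends to `0`. -/
theorem IsJostSolution.boundary_eq (hV : IntegrableOn V (Ioi 0)) (γ : ℝ) (hζ : 0 ≤ ζ.im)
    (hζ0 : ζ ≠ 0) {θ₁ θ₂ : ℝ → ℂ} (h₁ : IsJostSolution V ζ θ₁) (h₂ : IsJostSolution V ζ θ₂) :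
    γ * θ₁ 0 - hderiv θ₁ 0 = γ * θ₂ 0 - hderiv θ₂ 0 := by
  obtain ⟨φ, hφ, B, hB⟩ := exists_regularSolution hV γ hζ hζ0
  have h0 : ∀ θ : ℝ → ℂ, wronskian φ θ 0 = γ * θ 0 - hderiv θ 0 := fun θ => by
    rw [wronskian, hφ.value, hφ.slope, mul_one]
  rw [← h0, ← h0, ← sub_eq_zero]
  have hd := h₁.asymptotics.sub h₂.asymptotics
  have hd' := h₁.asymptotics_deriv.sub h₂.asymptotics_deriv
  rw [sub_self] at hd hd'
  set E : ℝ → ℂ := fun x => Complex.exp (Complex.I * ζ * x) with hE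
  have hbd : IsBoundedUnder (· ≤ ·) atTop ((‖·‖) ∘ fun x => E x * φ x) :=
    isBoundedUnder_of_eventually_le (a := B) (by
      filter_upwards [eventually_ge_atTop 0] with x hx using (hB x hx).1)
  have hbd' : IsBoundedUnder (· ≤ ·) atTop ((‖·‖) ∘ fun x => E x * hderiv φ x) :=
    isBoundedUnder_of_eventually_le (a := B) (by
      filter_upwards [eventually_ge_atTop 0] with x hx using (hB x hx).2)
  have hlim := (isBoundedUnder_le_mul_tendsto_zero hbd' hd).sub
    ((isBoundedUnder_le_mul_tendsto_zero hbd hd').const_mul (Complex.I * ζ))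
  rw [mul_zero, sub_zero] at hlim
  refine tendsto_nhds_unique (tendsto_const_nhds.congr' ?_) hlim
  filter_upwards [eventually_ge_atTop 0] with x hx
  rw [← wronskian_eq hV hφ.solution h₁.solution hx, ← wronskian_eq hV hφ.solution h₂.solution hx]
  have hEx : E x ≠ 0 := Complex.exp_ne_zero _
  simp only [wronskian]
  change _ = E x * hderiv φ x * (θ₁ x / E x - θ₂ x / E x) - Complex.I * ζ * (E x * φ x *
    (hderiv θ₁ x / (Complex.I * ζ * E x) - hderiv θ₂ x / (Complex.I * ζ * E x)))
  field_simp [Complex.I_ne_zero]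
  ring

theorem jostFunction_eq (hV : IntegrableOn V (Ioi 0)) (γ : ℝ) (hζ : 0 ≤ ζ.im) (hζ0 : ζ ≠ 0) :
    jostFunction V γ ζ = γ * jost V ζ 0 - hderiv (jost V ζ) 0 := by
  have hφ : IsRegularSolution V γ ζ (regularSolution V γ ζ) := by
    obtain ⟨φ, hφ, -⟩ := exists_regularSolution hV γ hζ hζ0
    have h : ∃ φ, IsRegularSolution V γ ζ φ := ⟨φ, hφ⟩
    rw [regularSolution, dif_pos h]
    exact h.choose_spec
  have hθ : IsJostSolution V ζ (jostSolution V ζ) := by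
    have h : ∃ θ, IsJostSolution V ζ θ := ⟨_, isJostSolution_jost hV hζ hζ0⟩
    rw [jostSolution, dif_pos h]
    exact h.choose_spec
  rw [jostFunction, wronskian, hφ.value, hφ.slope, mul_one]
  exact hθ.boundary_eq hV γ hζ hζ0 (isJostSolution_jost hV hζ hζ0)

theorem analyticAt_jostFunction (hV : IntegrableOn V (Ioi 0)) (γ : ℝ) (hζ : 0 < ζ.im) :
    AnalyticAt ℂ (jostFunction V γ) ζ := by
  have hU : IsOpen {ζ : ℂ | 0 < ζ.im} := isOpen_lt continuous_const Complex.continuous_im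
  refine DifferentiableOn.analyticAt (s := {ζ : ℂ | 0 < ζ.im}) ?_ (hU.mem_nhds hζ)
  have hne : ∀ w : ℂ, 0 < w.im → w ≠ 0 := fun w hw h => by simp [h] at hw
  refine DifferentiableOn.congr (f := fun w => γ * jost V w 0
    - (Complex.I * w * (2 - jost V w 0) - jostMoment V w)) (fun w hw => ?_) fun w hw => ?_
  · obtain ⟨h1, h2⟩ := differentiableAt_jost hV hw 0
    refine DifferentiableAt.differentiableWithinAt ?_
    fun_prop
  · rw [jostFunction_eq hV γ (le_of_lt hw) (hne w hw), hderiv_jost_zero hV (le_of_lt hw) (hne w hw)]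

theorem integrableOn_exp_decay {κ : ℝ} (hκ : 0 < κ) :
    IntegrableOn (fun x => Real.exp (-(κ * x))) (Ioi 0) := by
  simpa [neg_mul] using exp_neg_integrableOn_Ioi 0 hκ

theorem norm_jost_le (hV : IntegrableOn V (Ioi 0)) (hζ : 0 ≤ ζ.im) {r : ℝ} (hr : 0 < r)
    (hrζ : r ≤ ‖ζ‖) (x : ℝ) :
    ‖jost V ζ x‖ ≤ Real.exp (r⁻¹ * ∫ t, |extend V t|) * Real.exp (-(ζ.im * x)) := by
  rw [jost, norm_mul, norm_cexp_I_mul, mul_comm]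
  exact mul_le_mul_of_nonneg_right (norm_jostFactor_le hV hζ hr hrζ x) (Real.exp_pos _).le

/-- Lagrange's identity for `θ(·, ζ)` and the complex conjugate of `θ(·, ζ₁)`, over the whole
half-line. -/
theorem jost_lagrange (hV : IntegrableOn V (Ioi 0)) (γ : ℝ) {ζ₁ : ℂ} (hζ : 0 < ζ.im)
    (hζ₁ : 0 < ζ₁.im) :
    jost V ζ 0 * starRingEnd ℂ (jostFunction V γ ζ₁)
        - jostFunction V γ ζ * starRingEnd ℂ (jost V ζ₁ 0)
      = (ζ ^ 2 - starRingEnd ℂ (ζ₁ ^ 2))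
        * ∫ x in Ioi (0 : ℝ), jost V ζ x * starRingEnd ℂ (jost V ζ₁ x) := by
  have hne : ∀ w : ℂ, 0 < w.im → w ≠ 0 := fun w hw h => by simp [h] at hw
  have hJ := isJostSolution_jost hV hζ.le (hne ζ hζ)
  have hJ₁ := isJostSolution_jost hV hζ₁.le (hne ζ₁ hζ₁)
  obtain ⟨B, hB⟩ := hJ.exists_decay (hne ζ hζ)
  obtain ⟨B₁, hB₁⟩ := hJ₁.exists_decay (hne ζ₁ hζ₁)
  have hdec : ∀ (b κ : ℝ), 0 < κ → Tendsto (fun x => b * Real.exp (-(κ * x))) atTop (𝓝 0) :=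
    fun b κ hκ => by
      have h1 := Real.tendsto_exp_neg_atTop_nhds_zero.comp
        (tendsto_id.const_mul_atTop hκ)
      simpa using h1.const_mul b
  have hlim0 : ∀ (u : ℝ → ℂ) (b κ : ℝ), 0 < κ →
      (∀ x, 0 ≤ x → ‖u x‖ ≤ b * Real.exp (-(κ * x))) → Tendsto u atTop (𝓝 0) :=
    fun u b κ hκ hu => squeeze_zero_norm' (by
      filter_upwards [eventually_ge_atTop 0] with x hx using hu x hx) (hdec b κ hκ)
  have t1 := hlim0 _ _ _ hζ fun x hx => (hB x hx).1
  have t2 := hlim0 _ _ _ hζ fun x hx => (hB x hx).2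
  have t3 := hlim0 (fun x => starRingEnd ℂ (jost V ζ₁ x)) _ _ hζ₁ fun x hx => by
    rw [RCLike.norm_conj]; exact (hB₁ x hx).1
  have t4 := hlim0 (fun x => starRingEnd ℂ (hderiv (jost V ζ₁) x)) _ _ hζ₁ fun x hx => by
    rw [RCLike.norm_conj]; exact (hB₁ x hx).2
  have hW : Tendsto (fun x => wronskian (jost V ζ) (fun x => starRingEnd ℂ (jost V ζ₁ x)) x)
      atTop (𝓝 0) := by
    simpa [wronskian, hderiv_star] using (t2.mul t3).sub (t4.mul t1)
  have hint : IntegrableOn (fun x => jost V ζ x * starRingEnd ℂ (jost V ζ₁ x)) (Ioi 0) := by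
    have c1 := continuous_jost hV hζ.le (hne ζ hζ)
    have c2 := continuous_jost hV hζ₁.le (hne ζ₁ hζ₁)
    refine Integrable.mono' (((integrableOn_exp_decay (add_pos hζ hζ₁)).const_mul (B * B₁)))
      (c1.mul (Complex.continuous_conj.comp c2)).aestronglyMeasurable ?_
    rw [ae_restrict_iff' measurableSet_Ioi]
    refine Eventually.of_forall fun x hx => ?_
    rw [norm_mul, RCLike.norm_conj]
    refine (mul_le_mul (hB x (le_of_lt hx)).1 (hB₁ x (le_of_lt hx)).1 (norm_nonneg _)
      ((norm_nonneg _).trans (hB x (le_of_lt hx)).1)).trans (le_of_eq ?_)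
    rw [add_mul, neg_add, Real.exp_add]
    ring
  have hI := (intervalIntegral_tendsto_integral_Ioi 0 hint tendsto_id).const_mul
    (starRingEnd ℂ (ζ₁ ^ 2) - ζ ^ 2)
  have hW' := hW.sub_const (wronskian (jost V ζ) (fun x => starRingEnd ℂ (jost V ζ₁ x)) 0)
  have := tendsto_nhds_unique (hW'.congr' (by
    filter_upwards [eventually_ge_atTop 0] with x hx using
      wronskian_sub hV hJ.solution hJ₁.solution.star le_rfl hx)) hI
  rw [wronskian, hderiv_star] at this
  rw [jostFunction_eq hV γ hζ.le (hne ζ hζ), jostFunction_eq hV γ hζ₁.le (hne ζ₁ hζ₁)]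
  simp only [map_sub, map_mul, Complex.conj_ofReal] at this ⊢
  linear_combination -this

theorem exists_jost_ne_zero (hV : IntegrableOn V (Ioi 0)) (hζ : 0 ≤ ζ.im) (hζ0 : ζ ≠ 0) :
    ∃ x : ℝ, 0 < x ∧ jost V ζ x ≠ 0 := by
  obtain ⟨x, hx, hx0⟩ := (((tendsto_jostFactor hV hζ hζ0).eventually_ne one_ne_zero).and
    (eventually_gt_atTop 0)).exists
  exact ⟨x, hx0, mul_ne_zero (Complex.exp_ne_zero _) hx⟩

theorem integral_jost_ne_zero (hV : IntegrableOn V (Ioi 0)) (hζ : 0 < ζ.im) :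
    ∫ x in Ioi (0 : ℝ), jost V ζ x * starRingEnd ℂ (jost V ζ x) ≠ 0 := by
  have hζ0 : ζ ≠ 0 := fun h => by simp [h] at hζ
  have hc := continuous_jost hV hζ.le hζ0
  obtain ⟨x, hx0, hx⟩ := exists_jost_ne_zero hV hζ.le hζ0
  simp only [RCLike.mul_conj]
  have e : ∫ x in Ioi (0 : ℝ), ((‖jost V ζ x‖ : ℂ)) ^ 2
      = ((∫ x in Ioi (0 : ℝ), ‖jost V ζ x‖ ^ 2 : ℝ) : ℂ) := by
    rw [← integral_complex_ofReal]
    simp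
  have hint : IntegrableOn (fun x => ‖jost V ζ x‖ ^ 2) (Ioi 0) := by
    have hn := norm_jost_le hV hζ.le (norm_pos_iff.2 hζ0) le_rfl
    set B := Real.exp (‖ζ‖⁻¹ * ∫ t, |extend V t|)
    refine Integrable.mono' ((integrableOn_exp_decay (add_pos hζ hζ)).const_mul (B ^ 2))
      (hc.norm.pow 2).aestronglyMeasurable (Eventually.of_forall fun x => ?_)
    rw [Real.norm_of_nonneg (by positivity)]
    refine (pow_le_pow_left₀ (norm_nonneg _) (hn x) 2).trans (le_of_eq ?_)
    rw [add_mul, neg_add, Real.exp_add]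
    ring
  have hpos : 0 < ∫ x in Ioi (0 : ℝ), ‖jost V ζ x‖ ^ 2 := by
    rw [integral_pos_iff_support_of_nonneg (fun x => by positivity) hint,
      Measure.restrict_apply' measurableSet_Ioi]
    refine IsOpen.measure_pos volume (IsOpen.inter ?_ isOpen_Ioi) ⟨x, ?_, hx0⟩
    · exact (hc.norm.pow 2).isOpen_support
    · simpa using hx
  simp only [RCLike.ofReal_eq_complex_ofReal] at *
  rw [e]
  exact_mod_cast hpos.ne'

/-- Continuity of the integral in `jost_lagrange` at `ζ₁ = ζ`, by dominated convergence; the decay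
of the fixed factor `θ(·, ζ)` alone provides the dominating function. -/
theorem tendsto_integral_jost (hV : IntegrableOn V (Ioi 0)) (hζ : 0 < ζ.im) :
    Tendsto (fun ζ₁ => ∫ x in Ioi (0 : ℝ), jost V ζ x * starRingEnd ℂ (jost V ζ₁ x)) (𝓝 ζ)
      (𝓝 (∫ x in Ioi (0 : ℝ), jost V ζ x * starRingEnd ℂ (jost V ζ x))) := by
  have hζ0 : ζ ≠ 0 := fun h => by simp [h] at hζ
  have hr : 0 < ‖ζ‖ / 2 := by have := norm_pos_iff.2 hζ0; positivity
  have hU : IsOpen {ζ' : ℂ | 0 < ζ'.im ∧ ‖ζ‖ / 2 < ‖ζ'‖} :=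
    (isOpen_lt continuous_const Complex.continuous_im).inter
      (isOpen_lt continuous_const continuous_norm)
  have hn := hU.mem_nhds (x := ζ) ⟨hζ, by linarith⟩
  set B := Real.exp ((‖ζ‖ / 2)⁻¹ * ∫ t, |extend V t|)
  refine tendsto_integral_filter_of_dominated_convergence
    (fun x => B * Real.exp (-(ζ.im * x)) * B) ?_ ?_
    (((integrableOn_exp_decay hζ).const_mul B).mul_const B) ?_
  · filter_upwards [hn] with w hw
    exact ((continuous_jost hV hζ.le hζ0).mul (Complex.continuous_conj.comp
      (continuous_jost hV hw.1.le (norm_pos_iff.1 (hr.trans hw.2))))).aestronglyMeasurable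
  · filter_upwards [hn] with w hw
    rw [ae_restrict_iff' measurableSet_Ioi]
    refine Eventually.of_forall fun x hx => ?_
    have hB : 0 < B := Real.exp_pos _
    rw [norm_mul, RCLike.norm_conj]
    refine mul_le_mul (norm_jost_le hV hζ.le hr (by linarith) x) ?_ (norm_nonneg _) (by positivity)
    refine (norm_jost_le hV hw.1.le hr hw.2.le x).trans (mul_le_of_le_one_right hB.le ?_)
    rw [Real.exp_le_one_iff]
    have := mul_pos hw.1 hx
    linarith
  · refine Eventually.of_forall fun x => ?_
    exact ((Complex.continuous_conj.tendsto _).comp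
      (differentiableAt_jost hV hζ x).1.continuousAt.tendsto).const_mul _

/-- A zero of the Jost function has a real square, by `jost_lagrange` with `ζ₁ = ζ`. -/
theorem sq_real_of_jostFunction_eq_zero (hV : IntegrableOn V (Ioi 0)) (γ : ℝ) (hζ : 0 < ζ.im)
    (hw : jostFunction V γ ζ = 0) : starRingEnd ℂ (ζ ^ 2) = ζ ^ 2 := by
  have h := jost_lagrange hV γ hζ hζ
  rw [hw, map_zero, mul_zero, zero_mul, sub_zero] at h
  have := (mul_eq_zero.1 h.symm).resolve_right (integral_jost_ne_zero hV hζ)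
  exact (sub_eq_zero.1 this).symm

theorem re_eq_zero_of_sq_real (hζ : 0 < ζ.im) (h : starRingEnd ℂ (ζ ^ 2) = ζ ^ 2) :
    ζ.re = 0 := by
  have := Complex.conj_eq_iff_im.1 h
  rw [sq, Complex.mul_im] at this
  have h2 : ζ.re * ζ.im = 0 := by linarith
  exact (mul_eq_zero.1 h2).resolve_right hζ.ne'

/-- Simplicity of the zeros: dividing `jost_lagrange` by the conjugate of `ζ₁ - ζ` and letting
`ζ₁ → ζ` expresses the derivative through `∫ |θ|² ≠ 0`. -/
theorem deriv_jostFunction_ne_zero (hV : IntegrableOn V (Ioi 0)) (γ : ℝ) (hζ : 0 < ζ.im)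
    (hw : jostFunction V γ ζ = 0) : deriv (jostFunction V γ) ζ ≠ 0 := by
  intro hd
  have hζ0 : ζ ≠ 0 := fun h => by simp [h] at hζ
  have hsq := sq_real_of_jostFunction_eq_zero hV γ hζ hw
  have hder := (analyticAt_jostFunction hV γ hζ).differentiableAt.hasDerivAt
  rw [hd] at hder
  have h1 := ((Complex.continuous_conj.tendsto _).comp
    hder.tendsto_slope).const_mul (jost V ζ 0)
  rw [map_zero, mul_zero] at h1
  have h2 : Tendsto (fun ζ₁ : ℂ => -starRingEnd ℂ (ζ₁ + ζ) *
      ∫ x in Ioi (0 : ℝ), jost V ζ x * starRingEnd ℂ (jost V ζ₁ x)) (𝓝[≠] ζ)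
      (𝓝 (-starRingEnd ℂ (ζ + ζ) *
      ∫ x in Ioi (0 : ℝ), jost V ζ x * starRingEnd ℂ (jost V ζ x))) := by
    refine Tendsto.mono_left (Tendsto.mul ?_ (tendsto_integral_jost hV hζ)) nhdsWithin_le_nhds
    have : Continuous fun ζ₁ : ℂ => -starRingEnd ℂ (ζ₁ + ζ) :=
      (Complex.continuous_conj.comp (by fun_prop)).neg
    exact this.tendsto ζ
  have hU : IsOpen {ζ : ℂ | 0 < ζ.im} := isOpen_lt continuous_const Complex.continuous_im
  have heq := tendsto_nhds_unique (h1.congr' (by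
    filter_upwards [self_mem_nhdsWithin, nhdsWithin_le_nhds (hU.mem_nhds hζ)] with w hne hwU
    have hL := jost_lagrange hV γ hζ hwU
    rw [hw, zero_mul, sub_zero, ← hsq, ← map_sub] at hL
    have hne' : starRingEnd ℂ (w - ζ) ≠ 0 := by
      rw [Ne, map_eq_zero]; exact sub_ne_zero.2 hne
    simp only [Function.comp_apply, slope_def_field]
    rw [hw, sub_zero, map_div₀, ← mul_div_assoc, hL, div_eq_iff hne']
    simp only [map_sub, map_add, map_pow]
    ring)) h2
  have h3 : -starRingEnd ℂ (ζ + ζ) ≠ 0 := by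
    rw [neg_ne_zero, Ne, map_eq_zero, ← two_mul]
    exact mul_ne_zero two_ne_zero hζ0
  exact mul_ne_zero h3 (integral_jost_ne_zero hV hζ) heq.symm

/-- There are no real zeros: for real `ζ` the Wronskian of `θ` and its complex conjugate is
`2iζ`, but it vanishes at `0` if `θ` satisfies the boundary condition. -/
theorem jostFunction_ne_zero_of_real (hV : IntegrableOn V (Ioi 0)) (γ : ℝ) (hζ : ζ.im = 0)
    (hζ0 : ζ ≠ 0) : jostFunction V γ ζ ≠ 0 := by
  intro hw
  rw [jostFunction_eq hV γ hζ.ge hζ0] at hw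
  have hJ := isJostSolution_jost hV hζ.ge hζ0
  have hconj : starRingEnd ℂ ζ = ζ := Complex.conj_eq_iff_im.2 hζ
  have hstar := hJ.solution.star
  rw [map_pow, hconj] at hstar
  set ψ : ℝ → ℂ := fun x => starRingEnd ℂ (jost V ζ x) with hψ
  have h0 : wronskian (jost V ζ) ψ 0 = 0 := by
    have e : hderiv (jost V ζ) 0 = γ * jost V ζ 0 := by linear_combination -hw
    rw [wronskian, hψ, hderiv_star, e, map_mul, Complex.conj_ofReal]
    ring
  have hlim : Tendsto (fun x => Complex.I * ζ * (hderiv (jost V ζ) x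
        / (Complex.I * ζ * Complex.exp (Complex.I * ζ * x))
        * starRingEnd ℂ (jost V ζ x / Complex.exp (Complex.I * ζ * x)))
      + Complex.I * ζ * (starRingEnd ℂ (hderiv (jost V ζ) x
        / (Complex.I * ζ * Complex.exp (Complex.I * ζ * x)))
        * (jost V ζ x / Complex.exp (Complex.I * ζ * x)))) atTop
      (𝓝 (Complex.I * ζ * (1 * starRingEnd ℂ 1) + Complex.I * ζ * (starRingEnd ℂ 1 * 1))) := by
    have c := fun {f : ℝ → ℂ} (hf : Tendsto f atTop (𝓝 1)) =>
      (Complex.continuous_conj.tendsto 1).comp hf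
    exact ((hJ.asymptotics_deriv.mul (c hJ.asymptotics)).const_mul _).add
      (((c hJ.asymptotics_deriv).mul hJ.asymptotics).const_mul _)
  have heq := tendsto_nhds_unique (hlim.congr' (f₂ := fun _ => (0 : ℂ)) (by
    filter_upwards [eventually_ge_atTop 0] with x hx
    have hW := wronskian_eq hV hJ.solution hstar hx
    rw [h0, wronskian, hψ, hderiv_star] at hW
    have hE : Complex.exp (Complex.I * ζ * x) ≠ 0 := Complex.exp_ne_zero _
    have hEE : starRingEnd ℂ (Complex.exp (Complex.I * ζ * x)) * Complex.exp (Complex.I * ζ * x)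
        = 1 := by
      rw [← Complex.exp_conj, ← Complex.exp_add]
      simp [hconj]
    have hE' : starRingEnd ℂ (Complex.exp (Complex.I * ζ * x)) ≠ 0 := left_ne_zero_of_mul_eq_one hEE
    simp only [map_div₀, map_mul, Complex.conj_I, hconj]
    field_simp [Complex.I_ne_zero]
    linear_combination hW)) tendsto_const_nhds
  simp only [map_one, mul_one] at heq
  refine hζ0 ?_
  have : Complex.I * ζ = 0 := by linear_combination heq / 2
  exact (mul_eq_zero.1 this).resolve_left Complex.I_ne_zero

end

/-! ### The quadratic form on solutions -/

theorem memH1_of_decay {u : ℝ → ℂ} {B κ : ℝ} (hκ : 0 < κ)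
    (hu : ∀ b : ℝ, 0 ≤ b → AbsolutelyContinuousOnInterval u 0 b)
    (hb : ∀ x : ℝ, 0 < x → ‖u x‖ ≤ B * Real.exp (-(κ * x)))
    (hb' : ∀ᵐ x ∂halfLine, ‖deriv u x‖ ≤ B * Real.exp (-(κ * x))) : MemH1 u := by
  have hexp : MemLp (fun x => B * Real.exp (-(κ * x))) 2 halfLine := by
    rw [memLp_two_iff_integrable_sq (by fun_prop)]
    refine ((integrableOn_exp_decay (add_pos hκ hκ)).const_mul (B ^ 2)).congr
      (Eventually.of_forall fun x => ?_)
    simp only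
    rw [add_mul, neg_add, Real.exp_add]
    ring
  have huc := continuousOn_of_absCont hu
  refine ⟨hu, hexp.mono' (huc.aestronglyMeasurable measurableSet_Ioi) ?_,
    hexp.mono' (aestronglyMeasurable_deriv _ _) hb'⟩
  rw [ae_restrict_iff' measurableSet_Ioi]
  exact Eventually.of_forall hb

theorem MemH1.conj {u : ℝ → ℂ} (hu : MemH1 u) : MemH1 (fun x => starRingEnd ℂ (u x)) where
  absCont b hb := absCont_star (hu.absCont b hb)
  memLp := hu.memLp.star
  memLp_deriv := by
    have : deriv (fun x => starRingEnd ℂ (u x)) = fun x => starRingEnd ℂ (deriv u x) := by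
      funext x
      exact deriv.star
    rw [this]
    exact hu.memLp_deriv.star

theorem deriv_conj (u : ℝ → ℂ) (x : ℝ) :
    deriv (fun x => starRingEnd ℂ (u x)) x = starRingEnd ℂ (deriv u x) := deriv.star

theorem MemH1.integrable_mul {u v : ℝ → ℂ} (hu : MemH1 u) (hv : MemH1 v) :
    IntegrableOn (fun x => u x * v x) (Ioi 0) := MemLp.integrable_mul hu.memLp hv.memLp

/-- The bilinear version of `form_integrable`. -/
theorem integrableOn_bilinear {V : ℝ → ℝ} (hV : IntegrableOn V (Ioi 0)) (z : ℂ) {u v : ℝ → ℂ}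
    (hu : MemH1 u) (hv : MemH1 v) :
    IntegrableOn (fun x => deriv u x * deriv v x + ((V x : ℂ) - z) * v x * u x) (Ioi 0) := by
  have h1 := form_integrable hV hu hv.conj
  have h2 := h1.sub ((hu.integrable_mul hv).const_mul z)
  refine h2.congr (Eventually.of_forall fun x => ?_)
  simp only [Pi.sub_apply, deriv_conj, Complex.conj_conj]
  ring

/-- Integration by parts on `(a, ∞)`, for a solution whose derivative vanishes at infinity. -/
theorem IsSolution.integral_Ioi_eq {V : ℝ → ℝ} (hV : IntegrableOn V (Ioi 0)) {z : ℂ}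
    {u ψ : ℝ → ℂ} (hu : MemH1 u) (hψ : IsSolution V z ψ) (hψ1 : MemH1 ψ)
    (hlim : Tendsto (hderiv ψ) atTop (𝓝 0)) {a : ℝ} (ha : 0 ≤ a) :
    ∫ x in Ioi a, (deriv u x * deriv ψ x + ((V x : ℂ) - z) * ψ x * u x)
      = -(u a * hderiv ψ a) := by
  have hint := (integrableOn_bilinear hV z hu hψ1).mono_set (Ioi_subset_Ioi ha)
  have h1 := intervalIntegral_tendsto_integral_Ioi a hint tendsto_id
  obtain ⟨C, hC⟩ := hu.bounded
  have hbd : IsBoundedUnder (· ≤ ·) atTop ((‖·‖) ∘ u) :=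
    isBoundedUnder_of_eventually_le (a := C) (by
      filter_upwards [eventually_ge_atTop 0] with x hx using hC x hx)
  have h2 := (isBoundedUnder_le_mul_tendsto_zero hbd hlim).sub_const (u a * hderiv ψ a)
  rw [zero_sub] at h2
  refine tendsto_nhds_unique h1 (h2.congr' ?_)
  filter_upwards [eventually_ge_atTop a] with b hb
  rw [← (hψ.integral_eq hV hu.absCont ha hb).2]
  refine intervalIntegral.integral_congr_ae (Eventually.of_forall fun x hx => ?_)
  change x ∈ uIoc a b at hx
  rw [uIoc_of_le hb] at hx
  rw [(hψ.hasDerivAt (lt_of_le_of_lt ha hx.1)).deriv]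

section

variable {V : ℝ → ℝ} {ζ : ℂ}

theorem memH1_jost (hV : IntegrableOn V (Ioi 0)) (hζ : 0 < ζ.im) :
    MemH1 (jost V ζ) ∧ Tendsto (hderiv (jost V ζ)) atTop (𝓝 0) := by
  have hζ0 : ζ ≠ 0 := fun h => by simp [h] at hζ
  have hJ := isJostSolution_jost hV hζ.le hζ0
  obtain ⟨B, hB⟩ := hJ.exists_decay hζ0
  refine ⟨memH1_of_decay hζ hJ.solution.absCont_self (fun x hx => (hB x hx.le).1) ?_, ?_⟩
  · rw [ae_restrict_iff' measurableSet_Ioi]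
    refine Eventually.of_forall fun x hx => ?_
    rw [(hJ.solution.hasDerivAt hx).deriv]
    exact (hB x (le_of_lt hx)).2
  · have h1 := (Real.tendsto_exp_neg_atTop_nhds_zero.comp
      (tendsto_id.const_mul_atTop hζ)).const_mul B
    rw [mul_zero] at h1
    refine squeeze_zero_norm' ?_ h1
    filter_upwards [eventually_ge_atTop 0] with x hx using (hB x hx).2

/-- The Jost solution satisfies the weak eigenvalue equation, up to a boundary term with the Jost
function as its coefficient. -/
theorem form_jost (hV : IntegrableOn V (Ioi 0)) (γ : ℝ) (hζ : 0 < ζ.im) {v : ℝ → ℂ}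
    (hv : MemH1 v) : form V γ (jost V ζ) v
      = ζ ^ 2 * (∫ x in Ioi (0 : ℝ), jost V ζ x * starRingEnd ℂ (v x))
        + jostFunction V γ ζ * starRingEnd ℂ (v 0) := by
  have hζ0 : ζ ≠ 0 := fun h => by simp [h] at hζ
  have hJ := isJostSolution_jost hV hζ.le hζ0
  obtain ⟨h1, hlim⟩ := memH1_jost hV hζ
  have hI := hJ.solution.integral_Ioi_eq hV hv.conj h1 hlim le_rfl
  have hsplit : (∫ x in Ioi (0 : ℝ), (deriv (jost V ζ) x * starRingEnd ℂ (deriv v x)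
      + (V x : ℂ) * jost V ζ x * starRingEnd ℂ (v x)))
      - ζ ^ 2 * (∫ x in Ioi (0 : ℝ), jost V ζ x * starRingEnd ℂ (v x))
      = -(starRingEnd ℂ (v 0) * hderiv (jost V ζ) 0) := by
    rw [← hI, ← integral_const_mul,
      ← integral_sub (form_integrable hV h1 hv) ((h1.integrable_mul hv.conj).const_mul _)]
    refine integral_congr_ae (Eventually.of_forall fun x => ?_)
    simp only [deriv_conj]
    ring
  rw [form, jostFunction_eq hV γ hζ.le hζ0]
  linear_combination hsplit

/-! ### Zeros of the Jost function and eigenvalues -/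

/-- Eigenvalues of the Hamiltonian in terms of the form: `μ` is an eigenvalue iff the weak
eigenvalue equation has a solution in `H¹(ℝ₊)` that does not vanish identically. -/
theorem isEigenvalue_iff (hV : IntegrableOn V (Ioi 0)) (γ : ℝ) (μ : ℂ) :
    IsEigenvalue (hamiltonian V γ hV) μ ↔ ∃ u : ℝ → ℂ, MemH1 u ∧ (∃ x : ℝ, 0 < x ∧ u x ≠ 0) ∧
      ∀ v : ℝ → ℂ, MemH1 v →
        form V γ u v = μ * ∫ x in Ioi (0 : ℝ), u x * starRingEnd ℂ (v x) := by
  have hsmul : ∀ (p : L2) (u v : ℝ → ℂ), p =ᵐ[halfLine] u →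
      ∫ x in Ioi (0 : ℝ), (μ • p : L2) x * starRingEnd ℂ (v x)
        = μ * ∫ x in Ioi (0 : ℝ), u x * starRingEnd ℂ (v x) := fun p u v hp => by
    rw [← integral_const_mul]
    refine integral_congr_ae ?_
    filter_upwards [Lp.coeFn_smul μ p, hp] with x h1 h2
    rw [h1, Pi.smul_apply, h2, smul_eq_mul, mul_assoc]
  constructor
  · rintro ⟨p, hp0, hp⟩
    have hg : ((p : L2), μ • (p : L2)) ∈ (hamiltonian V γ hV).graph := by
      rw [← hp]; exact LinearPMap.mem_graph _ p
    rw [hamiltonian_graph] at hg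
    obtain ⟨u, hu, hpu, h⟩ := hg
    refine ⟨u, hu, ?_, fun v hv => (h v hv).trans (hsmul _ u v hpu)⟩
    by_contra! hne
    refine hp0 ?_
    rw [Lp.eq_zero_iff_ae_eq_zero]
    filter_upwards [hpu, ae_restrict_mem measurableSet_Ioi] with x h1 h2
    exact h1.trans (hne x h2)
  · rintro ⟨u, hu, ⟨x, hx0, hx⟩, h⟩
    set p : L2 := hu.memLp.toLp u with hp
    have hpu : p =ᵐ[halfLine] u := hu.memLp.coeFn_toLp
    have hg : (p, μ • p) ∈ (hamiltonian V γ hV).graph := by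
      rw [hamiltonian_graph]
      exact ⟨u, hu, hpu, fun v hv => (h v hv).trans (hsmul p u v hpu).symm⟩
    obtain ⟨y, hy1, hy2⟩ := (LinearPMap.mem_graph_iff _).1 hg
    simp only at hy1 hy2
    refine ⟨y, fun h0 => hx ?_, by rw [hy2, hy1]⟩
    rw [hy1] at h0
    have hu0 : u =ᵐ[halfLine] fun _ => 0 := by
      filter_upwards [hpu, (Lp.eq_zero_iff_ae_eq_zero).1 h0] with t h1 h2
      rw [← h1, h2, Pi.zero_apply]
    exact Measure.eqOn_open_of_ae_eq hu0 isOpen_Ioi (continuousOn_of_absCont hu.absCont)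
      continuousOn_const hx0

/-- Used with `m x = min x y` and `m x = max x y`, the arguments in Green's function. -/
theorem absCont_comp_of_lipschitz {V : ℝ → ℝ} {z : ℂ} {ψ : ℝ → ℂ} (hψ : IsSolution V z ψ)
    {m : ℝ → ℝ} (hm : LipschitzWith 1 m) {b c : ℝ} (hmaps : MapsTo m (uIcc 0 b) (Icc 0 c)) :
    AbsolutelyContinuousOnInterval (fun x => ψ (m x)) 0 b := by
  obtain ⟨K, hK⟩ := (hψ.contDiffOn.mono (fun x hx => hx.1 : Icc 0 c ⊆ Ici 0)).exists_lipschitzOnWith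
    (by decide) (convex_Icc _ _) isCompact_Icc
  exact (hK.comp hm.lipschitzOnWith hmaps).absolutelyContinuousOnInterval

/-- Testing the weak eigenvalue equation against Green's function
`x ↦ φ(min x y) θ(max x y)` shows that an eigenfunction vanishes at `y` unless `w(ζ) = 0`. -/
theorem jostFunction_mul_eq_zero (hV : IntegrableOn V (Ioi 0)) (γ : ℝ) (hζ : 0 < ζ.im)
    {u : ℝ → ℂ} (hu : MemH1 u)
    (h : ∀ v : ℝ → ℂ, MemH1 v →
      form V γ u v = ζ ^ 2 * ∫ x in Ioi (0 : ℝ), u x * starRingEnd ℂ (v x))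
    {y : ℝ} (hy : 0 < y) : u y * jostFunction V γ ζ = 0 := by
  have hζ0 : ζ ≠ 0 := fun h => by simp [h] at hζ
  have hJ := isJostSolution_jost hV hζ.le hζ0
  obtain ⟨hθ1, hlim⟩ := memH1_jost hV hζ
  obtain ⟨A, hA⟩ := hJ.exists_decay hζ0
  obtain ⟨φ, hφ, B, hB⟩ := exists_regularSolution hV γ hζ.le hζ0
  set θ := jost V ζ with hθ
  set G : ℝ → ℂ := fun x => φ (min x y) * θ (max x y) with hG
  have hA0 : 0 ≤ A := by simpa using (norm_nonneg _).trans (hA 0 le_rfl).1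
  have hB0 : 0 ≤ B := (norm_nonneg _).trans (hB 0 le_rfl).1
  have hBφ : ∀ x : ℝ, 0 ≤ x → ‖φ x‖ ≤ B * Real.exp (ζ.im * x) ∧
      ‖hderiv φ x‖ ≤ B * Real.exp (ζ.im * x) := fun x hx => by
    have hb := hB x hx
    rw [norm_mul, norm_mul, norm_cexp_I_mul, Real.exp_neg, ← div_eq_inv_mul, ← div_eq_inv_mul,
      div_le_iff₀ (Real.exp_pos _), div_le_iff₀ (Real.exp_pos _)] at hb
    exact hb
  -- Away from `x = y`, both `G` and `G'` are products of a factor at `s = min x y` of size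
  -- `O(e^{s Im ζ})` and a factor at `t = max x y` of size `O(e^{-t Im ζ})`.
  have hprod : ∀ {c d : ℂ} {s t x : ℝ}, ‖c‖ ≤ B * Real.exp (ζ.im * s) →
      ‖d‖ ≤ A * Real.exp (-(ζ.im * t)) → s - t ≤ y - x →
      ‖c * d‖ ≤ B * A * Real.exp (ζ.im * y) * Real.exp (-(ζ.im * x)) := by
    intro c d s t x hc hd hst
    rw [norm_mul]
    refine (mul_le_mul hc hd (norm_nonneg _) (by positivity)).trans ?_
    rw [mul_mul_mul_comm, ← Real.exp_add, mul_assoc (B * A), ← Real.exp_add]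
    refine mul_le_mul_of_nonneg_left (Real.exp_le_exp.2 ?_) (by positivity)
    nlinarith
  have hleft : ∀ x, x < y → G =ᶠ[𝓝 x] fun x => φ x * θ y := fun x hx => by
    filter_upwards [Iio_mem_nhds hx] with t ht
    have ht' : t < y := ht
    simp only [hG, min_eq_left ht'.le, max_eq_right ht'.le]
  have hright : ∀ x, y < x → G =ᶠ[𝓝 x] fun x => φ y * θ x := fun x hx => by
    filter_upwards [Ioi_mem_nhds hx] with t ht
    have ht' : y < t := ht
    simp only [hG, min_eq_right ht'.le, max_eq_left ht'.le]
  have hdl : ∀ x, 0 < x → x < y → deriv G x = hderiv φ x * θ y := fun x hx hxy => by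
    rw [(hleft x hxy).deriv_eq]
    exact ((hφ.solution.hasDerivAt hx).mul_const _).deriv
  have hdr : ∀ x, y < x → deriv G x = φ y * deriv θ x := fun x hxy => by
    rw [(hright x hxy).deriv_eq]
    exact ((hJ.solution.hasDerivAt (hy.trans hxy)).differentiableAt.hasDerivAt.const_mul _).deriv
  have hGac : ∀ b : ℝ, 0 ≤ b → AbsolutelyContinuousOnInterval G 0 b := fun b hb => by
    refine absCont_mul (absCont_comp_of_lipschitz hφ.solution (m := fun x => min x y) (c := b)
      (LipschitzWith.id.min_const y) fun x hx => ?_)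
      (absCont_comp_of_lipschitz hJ.solution (m := fun x => max x y) (c := max b y)
      (LipschitzWith.id.max_const y) fun x hx => ?_)
    · rw [uIcc_of_le hb] at hx
      exact ⟨le_min hx.1 hy.le, (min_le_left _ _).trans hx.2⟩
    · rw [uIcc_of_le hb] at hx
      exact ⟨hx.1.trans (le_max_left _ _), max_le_max_right y hx.2⟩
  have hne : ∀ᵐ x ∂halfLine, x ≠ y := by
    refine ae_restrict_of_ae ?_
    simp [ae_iff, measure_singleton]
  have hG1 : MemH1 G := by
    refine memH1_of_decay hζ hGac (B := B * A * Real.exp (ζ.im * y)) (fun x hx => ?_) ?_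
    · refine hprod (hBφ _ (le_min hx.le hy.le)).1 (hA _ (hx.le.trans (le_max_left _ _))).1 ?_
      linarith [min_le_right x y, le_max_left x y]
    · filter_upwards [hne, ae_restrict_mem measurableSet_Ioi] with x hxy hx
      rcases lt_or_gt_of_ne hxy with h1 | h1
      · rw [hdl x hx h1]
        exact hprod (hBφ x (le_of_lt hx)).2 (hA y hy.le).1 (by linarith)
      · rw [hdr x h1, (hJ.solution.hasDerivAt hx).deriv]
        exact hprod (hBφ y hy.le).1 (hA x (le_of_lt hx)).2 le_rfl
  have hform := h _ hG1.conj
  have hI1 : ∫ x in Ioi y, (deriv u x * deriv G x + ((V x : ℂ) - ζ ^ 2) * G x * u x)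
      = -(φ y * (u y * hderiv θ y)) := by
    rw [← mul_neg, ← hJ.solution.integral_Ioi_eq hV hu hθ1 hlim hy.le, ← integral_const_mul]
    refine setIntegral_congr_fun measurableSet_Ioi fun x hx => ?_
    rw [hdr x hx, (hright x hx).eq_of_nhds]
    ring
  have hI2 : ∫ x in Ioc 0 y, (deriv u x * deriv G x + ((V x : ℂ) - ζ ^ 2) * G x * u x)
      = θ y * (u y * hderiv φ y - u 0 * γ) := by
    rw [← hφ.slope, ← (hφ.solution.integral_eq hV hu.absCont le_rfl hy.le).2,
      intervalIntegral.integral_of_le hy.le, ← integral_const_mul, integral_Ioc_eq_integral_Ioo,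
      integral_Ioc_eq_integral_Ioo]
    refine setIntegral_congr_fun measurableSet_Ioo fun x hx => ?_
    rw [hdl x hx.1 hx.2, (hleft x hx.2).eq_of_nhds]
    ring
  have hint := integrableOn_bilinear hV (ζ ^ 2) hu hG1
  have hI : ∫ x in Ioi (0 : ℝ), (deriv u x * deriv G x + ((V x : ℂ) - ζ ^ 2) * G x * u x)
      = θ y * (u y * hderiv φ y - u 0 * γ) - φ y * (u y * hderiv θ y) := by
    rw [← Ioc_union_Ioi_eq_Ioi hy.le, setIntegral_union Ioc_disjoint_Ioi_same measurableSet_Ioi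
      (hint.mono_set fun x hx => hx.1) (hint.mono_set (Ioi_subset_Ioi hy.le)), hI1, hI2]
    ring
  have hG0 : G 0 = θ y := by
    simp only [hG, min_eq_left hy.le, max_eq_right hy.le, hφ.value, one_mul]
  have hsplit : ∫ x in Ioi (0 : ℝ), (deriv u x * deriv G x + ((V x : ℂ) - ζ ^ 2) * G x * u x)
      = (∫ x in Ioi (0 : ℝ), (deriv u x * starRingEnd ℂ (deriv (fun x => starRingEnd ℂ (G x)) x)
        + (V x : ℂ) * u x * starRingEnd ℂ (starRingEnd ℂ (G x))))
        - ζ ^ 2 * ∫ x in Ioi (0 : ℝ), u x * starRingEnd ℂ (starRingEnd ℂ (G x)) := by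
    rw [← integral_const_mul, ← integral_sub (form_integrable hV hu hG1.conj)
      ((hu.integrable_mul hG1.conj.conj).const_mul _)]
    refine integral_congr_ae (Eventually.of_forall fun x => ?_)
    simp only [deriv_conj, Complex.conj_conj]
    ring
  have hw := wronskian_eq hV hφ.solution hJ.solution hy.le
  rw [wronskian, wronskian, hφ.value, hφ.slope, mul_one, ← jostFunction_eq hV γ hζ.le hζ0] at hw
  rw [form, Complex.conj_conj, hG0] at hform
  rw [← hw]
  linear_combination hform + hsplit - hI

theorem jostFunction_eq_zero_iff (hV : IntegrableOn V (Ioi 0)) (γ : ℝ) (hζ : 0 < ζ.im) :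
    jostFunction V γ ζ = 0 ↔ IsEigenvalue (hamiltonian V γ hV) (ζ ^ 2) := by
  have hζ0 : ζ ≠ 0 := fun h => by simp [h] at hζ
  rw [isEigenvalue_iff]
  constructor
  · intro hw
    refine ⟨jost V ζ, (memH1_jost hV hζ).1, exists_jost_ne_zero hV hζ.le hζ0, fun v hv => ?_⟩
    rw [form_jost hV γ hζ hv, hw, zero_mul, add_zero]
  · rintro ⟨u, hu, ⟨y, hy, hy0⟩, h⟩
    exact (mul_eq_zero.1 (jostFunction_mul_eq_zero hV γ hζ hu h hy)).resolve_left hy0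

end

end

end RobinHalfLine

theorem mainTheorem9 (V : ℝ → ℝ) (hV : MeasureTheory.IntegrableOn V (Set.Ioi 0)) (γ : ℝ) :
    (∀ ζ : ℂ, 0 < ζ.im → RobinHalfLine.jostFunction V γ ζ = 0 →
      ζ.re = 0 ∧ analyticOrderAt (RobinHalfLine.jostFunction V γ) ζ = 1) ∧
    (∀ ζ : ℂ, 0 ≤ ζ.im → ζ ≠ 0 →
      (RobinHalfLine.jostFunction V γ ζ = 0 ↔
        ∃ μ : ℝ, μ < 0 ∧ (μ : ℂ) = ζ ^ 2 ∧
          RobinHalfLine.IsEigenvalue (RobinHalfLine.hamiltonian V γ hV) (μ : ℂ))) := by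
  refine ⟨fun ζ hζ hw => ⟨?_, ?_⟩, fun ζ hζ hζ0 => ⟨fun hw => ?_, ?_⟩⟩
  · exact RobinHalfLine.re_eq_zero_of_sq_real hζ
      (RobinHalfLine.sq_real_of_jostFunction_eq_zero hV γ hζ hw)
  · exact (RobinHalfLine.analyticAt_jostFunction
      hV γ hζ).analyticOrderAt_eq_one_of_zero_deriv_ne_zero hw
        (RobinHalfLine.deriv_jostFunction_ne_zero hV γ hζ hw)
  · have him : 0 < ζ.im := lt_of_le_of_ne hζ fun h =>
      RobinHalfLine.jostFunction_ne_zero_of_real hV γ h.symm hζ0 hw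
    have hre := RobinHalfLine.re_eq_zero_of_sq_real him
      (RobinHalfLine.sq_real_of_jostFunction_eq_zero hV γ him hw)
    have hsq : ((-(ζ.im ^ 2) : ℝ) : ℂ) = ζ ^ 2 := by
      apply Complex.ext <;> simp [sq, hre, -mul_eq_zero]
    refine ⟨-(ζ.im ^ 2), by have := pow_pos him 2; linarith, hsq, ?_⟩
    rw [hsq]
    exact (RobinHalfLine.jostFunction_eq_zero_iff hV γ him).1 hw
  · rintro ⟨μ, hμ, hμζ, he⟩
    -- A real `ζ` is excluded, since `ζ² = μ < 0`.
    have him : 0 < ζ.im := lt_of_le_of_ne hζ fun h => by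
      have h1 := congrArg Complex.re hμζ
      rw [sq, Complex.mul_re, ← h, Complex.ofReal_re] at h1
      nlinarith [mul_self_nonneg ζ.re]
    rw [hμζ] at he
    exact (RobinHalfLine.jostFunction_eq_zero_iff hV γ him).2 he
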